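/- For a prime $p$ and integers $m,n\ge 1$ let $Q$ be a random symmetric $n\times n$ matrix over $\mathbb{Z}/p^m\mathbb{Z}$ whose entries on and above the diagonal are independent and uniformly distributed on $\mathbb{Z}/p^m\mathbb{Z}$. Let $$\operatorname{rk}_d Q=\max\{j\le n:\ \text{there exists a non-zero minor of } Q \text{ of size } j\}$$ be its determinantal rank (the empty minor, of size $0$, equals $1$). Below, $p$ ranges over all odd primes and $n$ over all integers $n\ge1$. (1) As $m\to\infty$, uniformly in $n$ and $p$, $$\mathbb{P}\{\operatorname{rk}_d Q\le n-1\}\sim \frac{1-p^{-n}}{1-p^{-1}}\,p^{-m}.$$ (2) There are absolute constants $c,C>0$ (independent of $n$, $r$, $m$ and $p$) such that the following holds. For every $r\ge 2$ there is $M=M(r)$, independent of $n$ and $p$, such that for all $m\ge M$ and all $n$ with $r\le\lceil n/2\rceil$ $$c\,\frac{m}{r(r-1)}\,p^{-m(2r-1)}\le \mathbb{P}\{\operatorname{rk}_d Q\le n-r\},$$ and for all $m\ge 2$ and all $r,n$ with $2\le r\le\lceil n/2\rceil$ $$\mathbb{P}\{\operatorname{rk}_d Q\le n-r\}\le C\,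 m\log(\min(m,n))\,p^{-m(2r-1)}.$$ (3) There is an absolute constant $C'>0$ such that for all $m\ge1$, all $n\ge 1$ and all integers $r>\lceil n/2\rceil$ $$\mathbb{P}\{\operatorname{rk}_d Q\le n-r\}\le C'\,p^{-mn}.$$ -/

import Mathlib

open MeasureTheory ProbabilityTheory

/-- The determinantal rank of a square matrix over a commutative ring: the largest `j` for which
there is a non-zero minor of size `j` (rows and columns chosen independently). -/
noncomputable def detRank {R : Type*} [CommRing R] {n : ℕ} (A : Matrix (Fin n) (Fin n) R) : ℕ :=
  sSup {j : ℕ | ∃ f g : Fin j ↪o Fin n, (A.submatrix f g).det ≠ 0}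

/-- Over a nontrivial ring the supremum in `detRank` is a maximum (the empty minor is `1`). -/
theorem detRank_isGreatest {R : Type*} [CommRing R] [Nontrivial R] {n : ℕ}
    (A : Matrix (Fin n) (Fin n) R) :
    IsGreatest {j : ℕ | ∃ f g : Fin j ↪o Fin n, (A.submatrix f g).det ≠ 0} (detRank A) := by
  have hb : BddAbove {j : ℕ | ∃ f g : Fin j ↪o Fin n, (A.submatrix f g).det ≠ 0} := by
    refine ⟨n, ?_⟩
    rintro j ⟨f, -, -⟩
    simpa using Fintype.card_le_of_embedding f.toEmbedding
  have h0 : (0 : ℕ) ∈ {j : ℕ | ∃ f g : Fin j ↪o Fin n, (A.submatrix f g).det ≠ 0} := by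
    refine ⟨OrderEmbedding.ofIsEmpty, OrderEmbedding.ofIsEmpty, ?_⟩
    simp
  exact ⟨Nat.sSup_mem ⟨0, h0⟩ hb, fun j hj => le_csSup hb hj⟩

/-- The symmetric matrix whose entries at `(i, j)` and `(j, i)` are both `x s(i, j)`. -/
def symMatrix {R : Type*} {n : ℕ} (x : Sym2 (Fin n) → R) : Matrix (Fin n) (Fin n) R :=
  Matrix.of fun i j => x s(i, j)

theorem symMatrix_isSymm {R : Type*} {n : ℕ} (x : Sym2 (Fin n) → R) : (symMatrix x).IsSymm := by
  ext i j
  simp [symMatrix, Sym2.eq_swap]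

/-- The law of the free entries of a random symmetric `n × n` matrix over `ℤ/q`: one entry for each
unordered pair of indices, independent and uniform on `ℤ/q`. -/
noncomputable def entryLaw (q n : ℕ) : Measure (Sym2 (Fin n) → ZMod q) :=
  Measure.pi fun _ => uniformOn (Set.univ : Set (ZMod q))

instance entryLaw_isProbabilityMeasure (q n : ℕ) [NeZero q] :
    IsProbabilityMeasure (entryLaw q n) := by
  have : IsProbabilityMeasure (uniformOn (Set.univ : Set (ZMod q))) :=
    isProbabilityMeasure_uniformOn Set.finite_univ Set.univ_nonempty
  unfold entryLaw
  infer_instance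

/-- The probability that a random symmetric `n × n` matrix over `ℤ/p^m` has determinantal rank at
most `n - r` (an inequality of integers). -/
noncomputable def probRankLe (p m n r : ℕ) : ℝ :=
  (entryLaw (p ^ m) n).real {x | (detRank (symMatrix x) : ℤ) ≤ (n : ℤ) - (r : ℤ)}

/-! Set `q = p⁻¹` and let f(n, s) be the probability that a random symmetric n × n matrix over ℤ/p^s
has determinantal rank at most n - r. The proof derives a recursion for f and then does analysis on
that recursion alone.

Reveal the matrix one row at a time. If the diagonal entry is a unit, take a Schur complement. If it
is not, but some other unscaled entry of the row is a unit, take a Schur complement with respect to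
a 2 × 2 pivot. Otherwise the unscaled part of the row is divisible by p, and the row joins a growing
block of rows scaled by p. A Schur complement only translates the remaining uniform blocks
(`minorsInd_extendRight`), so the law is preserved (`scaledProb_unit_sum`). At the end a k × k
matrix p • C remains, with C uniform and k the corank mod p. Its minors of size k + 1 - r vanish mod
p^s exactly when those of C vanish mod p^(s-(k+1-r)), so f(n, s) is the sum over k ≥ r of
`corankProb q n k` * f(k, s - (k + 1 - r)) (`symProb_eq_sum`). The 2 × 2 pivots remove any need to
divide by 2; oddness of p serves only to give q ≤ 1/3.

For k ≤ n, `corankProb q n k` lies between 1/2 and 2 times q^(k(k+1)/2). Normalize f by q^(-σs); a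
passage to k then has weight about q^(tri k - σ(k+1-r)) and costs time k + 1 - r. For r = 1 and σ =
1, the function (1 - q^n)/(1 - q) is an exact fixed point, and the error contracts geometrically.
For r ≥ 2 and σ = 2r - 1 the exponent is (k-(2r-2))(k-(2r-1))/2: it vanishes only at k = 2r - 2 and
k = 2r - 1 and is positive elsewhere. The state 2r - 2 returns to itself with weight 1 after time r
- 1, so its normalized value stays bounded; the state 2r - 1 returns to itself after time r and is
fed by 2r - 2, so it grows linearly in the time. This resonance is the factor m. When n + 2 ≤ 2r the
slope σ = n leaves every weight small, and f(n, s) ≤ q^(ns). The upper bound obtained for 2 ≤ r is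
O(m), without the logarithm. -/

open Matrix

/-! ### Averages over finite groups -/

/-- The average of a real function over a finite type. -/
noncomputable def avg {α : Type*} (f : α → ℝ) : ℝ := (∑ᶠ x, f x) / Nat.card α

theorem avg_eq_sum {α : Type*} [Fintype α] (f : α → ℝ) :
    avg f = (∑ x, f x) / Fintype.card α := by
  rw [avg, finsum_eq_sum_of_fintype, Nat.card_eq_fintype_card]

theorem avg_equiv {α β : Type*} (e : α ≃ β) (f : β → ℝ) : avg (fun a => f (e a)) = avg f := by
  rw [avg, avg, Nat.card_congr e, finsum_comp_equiv e]

theorem avg_prod {α β : Type*} [Finite α] [Finite β] (f : α × β → ℝ) :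
    avg f = avg fun a => avg fun b => f (a, b) := by
  cases nonempty_fintype α
  cases nonempty_fintype β
  simp only [avg_eq_sum, Fintype.sum_prod_type, Fintype.card_prod, Nat.cast_mul]
  rw [← Finset.sum_div, div_div, mul_comm]

theorem avg_const {α : Type*} [Finite α] [Nonempty α] (c : ℝ) : avg (fun _ : α => c) = c := by
  cases nonempty_fintype α
  rw [avg_eq_sum]
  simp

theorem avg_add {α : Type*} [Finite α] (f g : α → ℝ) :
    avg (fun a => f a + g a) = avg f + avg g := by
  cases nonempty_fintype α
  simp only [avg_eq_sum, Finset.sum_add_distrib, add_div]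

theorem avg_const_mul {α : Type*} [Finite α] (c : ℝ) (f : α → ℝ) :
    avg (fun a => c * f a) = c * avg f := by
  cases nonempty_fintype α
  simp only [avg_eq_sum, ← Finset.mul_sum, mul_div_assoc]

theorem avg_nonneg {α : Type*} [Finite α] {f : α → ℝ} (h : ∀ a, 0 ≤ f a) : 0 ≤ avg f := by
  cases nonempty_fintype α
  rw [avg_eq_sum]
  exact div_nonneg (Finset.sum_nonneg fun a _ => h a) (Nat.cast_nonneg _)

open Classical in
theorem sum_comp_addMonoidHom {G H : Type*} [AddGroup G] [AddGroup H] [Fintype G] [Fintype H]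
    (φ : G →+ H) (F : H → ℝ) :
    ∑ x, F (φ x) = Nat.card φ.ker * ∑ h, if h ∈ φ.range then F h else 0 := by
  rw [← Finset.sum_fiberwise Finset.univ φ, Finset.mul_sum]
  refine Finset.sum_congr rfl fun h _ => ?_
  have : ∀ x ∈ Finset.univ.filter (fun x => φ x = h), F (φ x) = F h := by
    intro x hx
    rw [(Finset.mem_filter.1 hx).2]
  rw [Finset.sum_congr rfl this, Finset.sum_const, nsmul_eq_mul]
  split_ifs with hh
  · congr 2
    rw [AddMonoidHom.card_fiber_eq_of_mem_range φ hh φ.range.zero_mem, Nat.card_eq_fintype_card,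
      Fintype.card_subtype]
    simp [AddMonoidHom.mem_ker]
  · have : Finset.univ.filter (fun x => φ x = h) = ∅ := by
      ext x
      simpa using fun hx => hh ⟨x, hx⟩
    simp [this]

-- All fibres over the range have the same size, so a uniform element conditioned to lie in the
-- range is the image of a uniform element. With multiplication by p: a residue conditioned to be
-- divisible by p is p times a uniform one.
open Classical in
theorem avg_range_addMonoidHom {G H : Type*} [AddGroup G] [AddGroup H] [Finite G] [Finite H]
    (φ : G →+ H) (F : H → ℝ) :
    avg (fun h => if h ∈ φ.range then F h else 0) =
      avg (fun h => if h ∈ φ.range then 1 else 0) * avg fun x => F (φ x) := by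
  cases nonempty_fintype G
  cases nonempty_fintype H
  have h1 := sum_comp_addMonoidHom φ (fun _ => 1)
  have hk : (Nat.card φ.ker : ℝ) ≠ 0 := by
    exact_mod_cast Nat.card_pos.ne'
  have hG : (Fintype.card G : ℝ) ≠ 0 := by
    exact_mod_cast Fintype.card_ne_zero
  simp only [avg_eq_sum, sum_comp_addMonoidHom φ F]
  simp only [Finset.sum_const, Finset.card_univ, nsmul_eq_mul, mul_one] at h1
  rw [h1] at hG ⊢
  have h2 := right_ne_zero_of_mul hG
  field_simp
  ring_nf

theorem avg_comp_surjective {G H : Type*} [AddGroup G] [AddGroup H] [Finite G] [Finite H]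
    (φ : G →+ H) (hφ : Function.Surjective φ) (F : H → ℝ) :
    avg (fun x => F (φ x)) = avg F := by
  classical
  have h := avg_range_addMonoidHom φ F
  have hr : ∀ x, x ∈ φ.range := fun x => hφ x
  simpa [hr, avg_const] using h.symm

theorem avg_singleton {α : Type*} [Finite α] [DecidableEq α] (a : α) :
    avg (fun x => if x = a then (1 : ℝ) else 0) = 1 / Nat.card α := by
  cases nonempty_fintype α
  simp [avg_eq_sum]

/-! ### Vanishing of minors and Schur complements -/

theorem minors_eq_zero_of_le {ι R : Type*} [CommRing R] {A : Matrix ι ι R} {i j : ℕ} (hij : i ≤ j)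
    (h : ∀ f g : Fin i → ι, (A.submatrix f g).det = 0) (f g : Fin j → ι) :
    (A.submatrix f g).det = 0 := by
  induction hij with
  | refl => exact h f g
  | step _ ih =>
    rw [Matrix.det_succ_row_zero]
    refine Finset.sum_eq_zero fun c _ => ?_
    rw [Matrix.submatrix_submatrix, ih, mul_zero]

/-- All minors of size exceeding `card ι - r` vanish. -/
def MinorsVanish {ι R : Type*} [Fintype ι] [CommRing R] (r : ℕ) (A : Matrix ι ι R) : Prop :=
  ∀ (j : ℕ) (f g : Fin j → ι), Fintype.card ι < j + r → (A.submatrix f g).det = 0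

section
variable {ι κ R : Type*} [Fintype ι] [Fintype κ] [CommRing R] {r : ℕ}

/-- Multilinearity in the rows: a crude Cauchy–Binet formula. Summing over all functions h is
harmless because `MinorsVanish` admits arbitrary row and column choices. -/
theorem det_mul_submatrix [DecidableEq ι] (U : Matrix ι ι R) (A : Matrix ι ι R) {j : ℕ}
    (f g : Fin j → ι) :
    ((U * A).submatrix f g).det =
      ∑ h : Fin j → ι, (∏ i, U (f i) (h i)) * (A.submatrix h g).det := by
  have h1 : ((U * A).submatrix f g) = fun i => ∑ l, U (f i) l • fun c => A l (g c) := by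
    ext i c
    simp [Matrix.mul_apply]
  rw [h1]
  change detRowAlternating.toMultilinearMap _ = _
  rw [MultilinearMap.map_sum]
  refine Finset.sum_congr rfl fun h _ => ?_
  rw [MultilinearMap.map_smul_univ]
  rfl

theorem MinorsVanish.mul_left [DecidableEq ι] {A : Matrix ι ι R} (h : MinorsVanish r A)
    (U : Matrix ι ι R) : MinorsVanish r (U * A) := by
  intro j f g hj
  rw [det_mul_submatrix]
  exact Finset.sum_eq_zero fun k _ => by rw [h j k g hj, mul_zero]

theorem MinorsVanish.transpose {A : Matrix ι ι R} (h : MinorsVanish r A) :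
    MinorsVanish r Aᵀ := by
  intro j f g hj
  rw [← Matrix.transpose_submatrix, Matrix.det_transpose]
  exact h j g f hj

theorem MinorsVanish.mul_right [DecidableEq ι] {A : Matrix ι ι R} (h : MinorsVanish r A)
    (U : Matrix ι ι R) : MinorsVanish r (A * U) := by
  have := (h.transpose.mul_left Uᵀ).transpose
  rwa [← Matrix.transpose_mul, Matrix.transpose_transpose] at this

theorem minorsVanish_mul_mul_iff [DecidableEq ι] {A U V : Matrix ι ι R} (hU : IsUnit U.det)
    (hV : IsUnit V.det) : MinorsVanish r (U * A * V) ↔ MinorsVanish r A := by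
  refine ⟨fun h => ?_, fun h => (h.mul_left U).mul_right V⟩
  have := (h.mul_left U⁻¹).mul_right V⁻¹
  rwa [Matrix.mul_assoc U, Matrix.nonsing_inv_mul_cancel_left _ _ hU,
    Matrix.mul_nonsing_inv_cancel_right _ _ hV] at this

theorem minorsVanish_submatrix_equiv (e : κ ≃ ι) (A : Matrix ι ι R) :
    MinorsVanish r (A.submatrix e e) ↔ MinorsVanish r A := by
  have hc := Fintype.card_congr e
  constructor
  · intro h j f g hj
    have := h j (e.symm ∘ f) (e.symm ∘ g) (by omega)
    simpa [Matrix.submatrix_submatrix, Function.comp_def] using this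
  · intro h j f g hj
    exact h j (e ∘ f) (e ∘ g) (by omega)

theorem minorsVanish_of_subsingleton [Subsingleton R] (A : Matrix ι ι R) : MinorsVanish r A :=
  fun _ _ _ _ => Subsingleton.elim _ _

theorem not_minorsVanish [Nontrivial R] (A : Matrix ι ι R) (h : Fintype.card ι < r) :
    ¬ MinorsVanish r A := by
  intro hA
  simpa using hA 0 Fin.elim0 Fin.elim0 (by omega)

/-- The number of indices and the size of the relevant minors both grow by one, so r does not
change. In the converse direction a minor containing the new row once is expanded along it; one
containing it twice has equal rows. -/
theorem minorsVanish_unit_sum_iff (B : Matrix κ κ R) :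
    MinorsVanish r (fromBlocks (1 : Matrix Unit Unit R) 0 0 B) ↔ MinorsVanish r B := by
  have hcard : Fintype.card (Unit ⊕ κ) = Fintype.card κ + 1 := by simp [add_comm]
  constructor
  · intro h j f g hj
    have := h (j + 1) (Fin.cons (Sum.inl ()) (Sum.inr ∘ f)) (Fin.cons (Sum.inl ()) (Sum.inr ∘ g))
      (by omega)
    rw [Matrix.det_succ_row_zero, Fin.sum_univ_succ, Finset.sum_eq_zero] at this
    · simpa [Matrix.submatrix, Function.comp_def] using this
    · intro x _
      simp
  · intro h j f g hj
    cases j with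
    | zero =>
      have := h 0 Fin.elim0 Fin.elim0 (by omega)
      simpa using this
    | succ j =>
      have hB : ∀ f' g' : Fin j → κ, (B.submatrix f' g').det = 0 := fun f' g' =>
        h j f' g' (by omega)
      have key : ∀ (f' g' : Fin j → Unit ⊕ κ), (∀ i, ∃ x, f' i = Sum.inr x) →
          ((fromBlocks (1 : Matrix Unit Unit R) 0 0 B).submatrix f' g').det = 0 := by
        intro f' g' hf
        choose f₁ hf₁ using hf
        by_cases hg : ∃ c, g' c = Sum.inl ()
        · obtain ⟨c, hc⟩ := hg
          refine Matrix.det_eq_zero_of_column_eq_zero c fun i => ?_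
          simp [hf₁, hc]
        · have : ∀ c, ∃ x, g' c = Sum.inr x := by
            intro c
            rcases hc : g' c with x | x
            · exact absurd ⟨c, hc⟩ hg
            · exact ⟨x, rfl⟩
          choose g₁ hg₁ using this
          rw [← hB f₁ g₁]
          congr 1
          ext i c
          simp [hf₁, hg₁]
      by_cases hf : ∃ i, f i = Sum.inl ()
      · obtain ⟨i, hi⟩ := hf
        by_cases hi' : ∃ i', i' ≠ i ∧ f i' = Sum.inl ()
        · obtain ⟨i', hne, hi'⟩ := hi'
          refine Matrix.det_zero_of_row_eq hne ?_
          ext c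
          simp [hi, hi']
        · rw [Matrix.det_succ_row _ i]
          refine Finset.sum_eq_zero fun c _ => ?_
          rw [Matrix.submatrix_submatrix, key, mul_zero]
          intro l
          rcases hl : (f ∘ i.succAbove) l with x | x
          · exact absurd ⟨_, Fin.succAbove_ne i l, hl⟩ hi'
          · exact ⟨x, rfl⟩
      · rw [Matrix.det_succ_row_zero]
        refine Finset.sum_eq_zero fun c _ => ?_
        rw [Matrix.submatrix_submatrix, key, mul_zero]
        intro l
        rcases hl : (f ∘ Fin.succ) l with x | x
        · exact absurd ⟨_, hl⟩ hf
        · exact ⟨x, rfl⟩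

theorem minorsVanish_fromBlocks_one_fin (a : ℕ) (B : Matrix κ κ R) :
    MinorsVanish r (fromBlocks (1 : Matrix (Fin a) (Fin a) R) 0 0 B) ↔ MinorsVanish r B := by
  induction a with
  | zero =>
    rw [← minorsVanish_submatrix_equiv (Equiv.emptySum (Fin 0) κ) B]
    have : B.submatrix (Equiv.emptySum (Fin 0) κ) (Equiv.emptySum (Fin 0) κ) =
        fromBlocks (1 : Matrix (Fin 0) (Fin 0) R) 0 0 B := by
      ext i j
      rcases i with i | i
      · exact i.elim0
      rcases j with j | j
      · exact j.elim0
      rfl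
    rw [this]
  | succ a ih =>
    rw [← ih, ← minorsVanish_unit_sum_iff (fromBlocks (1 : Matrix (Fin a) (Fin a) R) 0 0 B)]
    let e₀ : Unit ⊕ Fin a ≃ Fin (a + 1) :=
      (Equiv.sumComm _ _).trans ((Equiv.optionEquivSumPUnit (Fin a)).symm.trans
        (finSuccEquiv a).symm)
    let e : Unit ⊕ (Fin a ⊕ κ) ≃ Fin (a + 1) ⊕ κ :=
      (Equiv.sumAssoc _ _ _).symm.trans (Equiv.sumCongr e₀ (Equiv.refl κ))
    rw [← minorsVanish_submatrix_equiv e]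
    have : (fromBlocks (1 : Matrix (Fin (a + 1)) (Fin (a + 1)) R) 0 0 B).submatrix e e =
        fromBlocks (1 : Matrix Unit Unit R) 0 0 (fromBlocks (1 : Matrix (Fin a) (Fin a) R) 0 0 B) := by
      ext i j
      rcases i with i | i | i <;> rcases j with j | j | j <;>
        simp [e, e₀, Matrix.one_apply, Fin.succ_ne_zero, (Fin.succ_ne_zero _).symm]
    rw [this]

/-- Block elimination turns the matrix into diag(1, Schur complement) up to invertible factors, and
the identity block is then peeled off. -/
theorem minorsVanish_fromBlocks_iff [DecidableEq ι] [DecidableEq κ] (E : Matrix ι ι R)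
    (hE : IsUnit E.det) (X : Matrix ι κ R) (Y : Matrix κ ι R) (W : Matrix κ κ R) :
    MinorsVanish r (fromBlocks E X Y W) ↔ MinorsVanish r (W - Y * E⁻¹ * X) := by
  let _ := Matrix.invertibleOfIsUnitDet E hE
  let e : Fin (Fintype.card ι) ⊕ κ ≃ ι ⊕ κ :=
    Equiv.sumCongr (Fintype.equivFin ι).symm (Equiv.refl κ)
  have h1 : fromBlocks E X Y W =
      (fromBlocks 1 0 (Y * E⁻¹) 1 * fromBlocks E 0 0 1) * fromBlocks 1 0 0 (W - Y * E⁻¹ * X) *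
        fromBlocks 1 (E⁻¹ * X) 0 1 := by
    simp only [fromBlocks_multiply]
    simp [Matrix.mul_assoc]
  rw [h1, minorsVanish_mul_mul_iff, ← minorsVanish_fromBlocks_one_fin (Fintype.card ι) (W - _),
    ← minorsVanish_submatrix_equiv e]
  · have : (fromBlocks (1 : Matrix ι ι R) 0 0 (W - Y * E⁻¹ * X)).submatrix e e =
        fromBlocks 1 0 0 (W - Y * E⁻¹ * X) := by
      ext i j
      rcases i with i | i <;> rcases j with j | j <;> simp [e, Matrix.one_apply]
    rw [this]
  · simpa [Matrix.det_mul] using hE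
  · simp
end

/-! ### Comparison with the determinantal rank -/

theorem exists_orderEmbedding_comp_perm {j n : ℕ} {f : Fin j → Fin n} (hf : Function.Injective f) :
    ∃ (e : Fin j ↪o Fin n) (σ : Equiv.Perm (Fin j)), f = e ∘ σ := by
  refine ⟨OrderEmbedding.ofStrictMono (f ∘ Tuple.sort f)
    ((Tuple.monotone_sort f).strictMono_of_injective (hf.comp (Equiv.injective _))),
    (Tuple.sort f)⁻¹, ?_⟩
  ext i
  simp

theorem minorsVanish_iff_detRank_le {R : Type*} [CommRing R] [Nontrivial R] {n : ℕ} (r : ℕ)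
    (A : Matrix (Fin n) (Fin n) R) :
    MinorsVanish r A ↔ (detRank A : ℤ) ≤ (n : ℤ) - (r : ℤ) := by
  have hA := detRank_isGreatest A
  constructor
  · intro h
    obtain ⟨f, g, hfg⟩ := hA.1
    by_contra hlt
    exact hfg (h _ f g (by rw [Fintype.card_fin]; omega))
  · intro h j f g hj
    rw [Fintype.card_fin] at hj
    by_cases hf : Function.Injective f
    · by_cases hg : Function.Injective g
      · obtain ⟨f', σ, rfl⟩ := exists_orderEmbedding_comp_perm hf
        obtain ⟨g', τ, rfl⟩ := exists_orderEmbedding_comp_perm hg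
        have h0 : (A.submatrix f' g').det = 0 := by
          by_contra hne
          have := hA.2 ⟨f', g', hne⟩
          omega
        have : A.submatrix (f' ∘ σ) (g' ∘ τ) =
            ((A.submatrix f' g').submatrix σ id).submatrix id τ := by
          ext; rfl
        rw [this, Matrix.det_permute', Matrix.det_permute, h0]
        simp
      · simp only [Function.Injective, not_forall] at hg
        obtain ⟨a, b, hab, hne⟩ := hg
        exact Matrix.det_zero_of_column_eq hne fun i => by simp [hab]
    · simp only [Function.Injective, not_forall] at hf
      obtain ⟨a, b, hab, hne⟩ := hf
      exact Matrix.det_zero_of_row_eq hne (by ext; simp [hab])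

/-! ### Symmetric matrices in blocks and the effect of a pivot -/

/-- The additive group of symmetric matrices. -/
def symMats (ι R : Type*) [AddCommGroup R] : AddSubgroup (Matrix ι ι R) where
  carrier := {A | A.IsSymm}
  zero_mem' := Matrix.isSymm_zero
  add_mem' := fun ha hb => Matrix.IsSymm.add ha hb
  neg_mem' := fun ha => Matrix.IsSymm.neg ha

section
variable {ι κ ν π R : Type*} [CommRing R]

/-- The free blocks of a symmetric matrix over `κ ⊕ ν`. -/
abbrev SymBlocks (κ ν R : Type*) [CommRing R] : Type _ :=
  symMats κ R × Matrix κ ν R × symMats ν R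

/-- The symmetric matrix with the given blocks, where rows and columns in `κ` are scaled by `c`
(only once in the intersection). -/
def SymBlocks.scaled (c : ℕ) (x : SymBlocks κ ν R) : Matrix (κ ⊕ ν) (κ ⊕ ν) R :=
  fromBlocks (c • x.1.1) (c • x.2.1) (c • x.2.1ᵀ) x.2.2.1

/-- The free blocks of the rows in `π` of a symmetric matrix over `κ ⊕ (π ⊕ ν)`. -/
abbrev PivotRows (κ ν π R : Type*) [CommRing R] : Type _ :=
  (symMats π R × Matrix ν π R) × Matrix κ π R

/-- Adding rows to the second block. -/
def SymBlocks.extendRight (y : PivotRows κ ν π R) (x : SymBlocks κ ν R) :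
    SymBlocks κ (π ⊕ ν) R :=
  (x.1, fromCols y.2 x.2.1, ⟨fromBlocks y.1.1.1 y.1.2ᵀ y.1.2 x.2.2.1,
    Matrix.IsSymm.fromBlocks y.1.1.2 (by simp) x.2.2.2⟩)

/-- Adding rows to the first block. -/
def SymBlocks.extendLeft (y : PivotRows κ ν π R) (x : SymBlocks κ ν R) :
    SymBlocks (κ ⊕ π) ν R :=
  (⟨fromBlocks x.1.1 y.2 y.2ᵀ y.1.1.1, Matrix.IsSymm.fromBlocks x.1.2 rfl y.1.1.2⟩,
    fromRows x.2.1 y.1.2ᵀ, x.2.2)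

/-- Splitting off rows from the second block. -/
def extendRightEquiv : PivotRows κ ν π R × SymBlocks κ ν R ≃ SymBlocks κ (π ⊕ ν) R where
  toFun z := SymBlocks.extendRight z.1 z.2
  invFun x :=
    (((⟨x.2.2.1.toBlocks₁₁, by ext i j; exact congr_fun (congr_fun x.2.2.2 (.inl i)) (.inl j)⟩,
      x.2.2.1.toBlocks₂₁), x.2.1.toCols₁),
     (x.1, x.2.1.toCols₂,
      ⟨x.2.2.1.toBlocks₂₂, by ext i j; exact congr_fun (congr_fun x.2.2.2 (.inr i)) (.inr j)⟩))
  left_inv z := by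
    simp [SymBlocks.extendRight]
  right_inv x := by
    obtain ⟨C, B, A, hA⟩ := x
    have h : A.toBlocks₂₁ᵀ = A.toBlocks₁₂ := by
      ext i j
      exact congr_fun (congr_fun hA (.inl i)) (.inr j)
    simp [SymBlocks.extendRight, h, fromBlocks_toBlocks]

/-- Splitting off rows from the first block. -/
def extendLeftEquiv : PivotRows κ ν π R × SymBlocks κ ν R ≃ SymBlocks (κ ⊕ π) ν R where
  toFun z := SymBlocks.extendLeft z.1 z.2
  invFun x :=
    (((⟨x.1.1.toBlocks₂₂, by ext i j; exact congr_fun (congr_fun x.1.2 (.inr i)) (.inr j)⟩,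
      x.2.1.toRows₂ᵀ), x.1.1.toBlocks₁₂),
     (⟨x.1.1.toBlocks₁₁, by ext i j; exact congr_fun (congr_fun x.1.2 (.inl i)) (.inl j)⟩,
      x.2.1.toRows₁, x.2.2))
  left_inv z := by
    simp [SymBlocks.extendLeft]
  right_inv x := by
    obtain ⟨⟨C, hC⟩, B, A⟩ := x
    have h : C.toBlocks₁₂ᵀ = C.toBlocks₂₁ := by
      ext i j
      exact congr_fun (congr_fun hC (.inr i)) (.inl j)
    simp [SymBlocks.extendLeft, h, fromBlocks_toBlocks]

/-- Relabelling the indices of the blocks. -/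
def symBlocksCongr {κ' ν' : Type*} (e : κ' ≃ κ) (f : ν' ≃ ν) :
    SymBlocks κ ν R ≃ SymBlocks κ' ν' R where
  toFun x := (⟨x.1.1.submatrix e e, Matrix.IsSymm.submatrix x.1.2 e⟩, x.2.1.submatrix e f,
    ⟨x.2.2.1.submatrix f f, Matrix.IsSymm.submatrix x.2.2.2 f⟩)
  invFun x := (⟨x.1.1.submatrix e.symm e.symm, Matrix.IsSymm.submatrix x.1.2 e.symm⟩,
    x.2.1.submatrix e.symm f.symm,
    ⟨x.2.2.1.submatrix f.symm f.symm, Matrix.IsSymm.submatrix x.2.2.2 f.symm⟩)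
  left_inv x := by simp
  right_inv x := by simp

theorem mul_inv_mul_transpose_mem_symMats [Fintype π] [DecidableEq π] {E : Matrix π π R}
    (hE : E ∈ symMats π R) (β : Matrix κ π R) : β * E⁻¹ * βᵀ ∈ symMats κ R := by
  have hE' : Eᵀ = E := hE
  change (_ : Matrix _ _ _)ᵀ = _
  simp [Matrix.transpose_nonsing_inv, Matrix.mul_assoc, hE']

variable [Fintype κ] [Fintype ν] [Fintype π] [Fintype ι]

open Classical in
/-- Indicator of the vanishing of all minors of size exceeding `card ι - r`. -/
noncomputable def minorsInd (r : ℕ) (A : Matrix ι ι R) : ℝ := if MinorsVanish r A then 1 else 0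

theorem minorsInd_congr {r : ℕ} {A : Matrix ι ι R} {ι' R' : Type*} [Fintype ι'] [CommRing R']
    {r' : ℕ} {A' : Matrix ι' ι' R'} (h : MinorsVanish r A ↔ MinorsVanish r' A') :
    minorsInd r A = minorsInd r' A' := by
  simp only [minorsInd]
  split_ifs <;> tauto

/-- Probability that the minors of size exceeding `card (κ ⊕ ν) - r` vanish, for a random symmetric
matrix whose rows and columns in `κ` are scaled by `c`. -/
noncomputable def scaledProb (κ ν R : Type*) [CommRing R] [Fintype κ] [Fintype ν] (r : ℕ) (c : ℕ) : ℝ :=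
  avg fun x : SymBlocks κ ν R => minorsInd r (x.scaled c)

theorem scaledProb_congr {κ' ν' : Type*} [Fintype κ'] [Fintype ν'] (e : κ' ≃ κ) (f : ν' ≃ ν)
    (r : ℕ) (c : ℕ) : scaledProb κ' ν' R r c = scaledProb κ ν R r c := by
  rw [scaledProb, scaledProb, ← avg_equiv (symBlocksCongr e f)]
  congr 1
  ext x
  refine minorsInd_congr ?_
  rw [← minorsVanish_submatrix_equiv (Equiv.sumCongr e f) (x.scaled c)]
  have : (x.scaled c).submatrix (Equiv.sumCongr e f) (Equiv.sumCongr e f) =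
      SymBlocks.scaled c (symBlocksCongr e f x) := by
    ext i j
    rcases i with i | i <;> rcases j with j | j <;> rfl
  rw [this]

/-- The scaled shape survives the Schur complement: the correction in the κ block is c² β E⁻¹ βᵀ = c
• (c • β E⁻¹ βᵀ), and that in the mixed block carries one factor c. The pivot thus merely translates
the free blocks. -/
theorem minorsInd_extendRight [DecidableEq κ] [DecidableEq ν] [DecidableEq π] (r : ℕ) (c : ℕ)
    (y : PivotRows κ ν π R) (hE : IsUnit y.1.1.1.det) (x : SymBlocks κ ν R) :
    minorsInd r ((SymBlocks.extendRight y x).scaled c) = minorsInd r (SymBlocks.scaled c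
      (x - (⟨c • (y.2 * y.1.1.1⁻¹ * y.2ᵀ),
          nsmul_mem (mul_inv_mul_transpose_mem_symMats y.1.1.2 _) c⟩,
        y.2 * y.1.1.1⁻¹ * y.1.2ᵀ, ⟨y.1.2 * y.1.1.1⁻¹ * y.1.2ᵀ,
          mul_inv_mul_transpose_mem_symMats y.1.1.2 _⟩))) := by
  obtain ⟨⟨⟨E, hEs⟩, ω⟩, β⟩ := y
  obtain ⟨⟨C, hC⟩, B, ⟨A, hA⟩⟩ := x
  dsimp only at hE ⊢
  refine minorsInd_congr ?_
  have hEs' : Eᵀ = E := hEs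
  let e : π ⊕ (κ ⊕ ν) ≃ κ ⊕ (π ⊕ ν) :=
    (Equiv.sumAssoc _ _ _).symm.trans
      ((Equiv.sumCongr (Equiv.sumComm π κ) (Equiv.refl ν)).trans (Equiv.sumAssoc _ _ _))
  rw [← minorsVanish_submatrix_equiv e]
  have h1 : (SymBlocks.scaled c (SymBlocks.extendRight ((⟨E, hEs⟩, ω), β)
      (⟨C, hC⟩, B, ⟨A, hA⟩))).submatrix e e = fromBlocks E (fromCols (c • βᵀ) ωᵀ)
        (fromRows (c • β) ω) (fromBlocks (c • C) (c • B) (c • Bᵀ) A) := by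
    ext i j
    rcases i with i | i | i <;> rcases j with j | j | j <;> rfl
  rw [h1, minorsVanish_fromBlocks_iff E hE, fromRows_mul, fromRows_mul_fromCols]
  have h2 : fromBlocks (c • C) (c • B) (c • Bᵀ) A -
      fromBlocks ((c • β) * E⁻¹ * (c • βᵀ)) ((c • β) * E⁻¹ * ωᵀ) (ω * E⁻¹ * (c • βᵀ))
        (ω * E⁻¹ * ωᵀ) = SymBlocks.scaled c
      ((⟨C, hC⟩, B, ⟨A, hA⟩) - (⟨c • (β * E⁻¹ * βᵀ),
          nsmul_mem (mul_inv_mul_transpose_mem_symMats hEs _) c⟩,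
        β * E⁻¹ * ωᵀ, ⟨ω * E⁻¹ * ωᵀ,
          mul_inv_mul_transpose_mem_symMats hEs _⟩)) := by
    rw [SymBlocks.scaled]
    simp only [Prod.mk_sub_mk, AddSubgroup.coe_sub, smul_sub,
      Matrix.transpose_sub]
    ext i j
    rcases i with i | i <;> rcases j with j | j <;>
      simp [Matrix.transpose_nonsing_inv, Matrix.mul_assoc, hEs']
  rw [h2]

theorem avg_minorsInd_extendRight [Finite R] [DecidableEq π] (r : ℕ) (c : ℕ)
    (y : PivotRows κ ν π R) (hE : IsUnit y.1.1.1.det) :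
    (avg fun x : SymBlocks κ ν R => minorsInd r ((SymBlocks.extendRight y x).scaled c)) =
      scaledProb κ ν R r c := by
  classical
  rw [scaledProb]
  simp only [minorsInd_extendRight r c y hE]
  exact avg_equiv (Equiv.subRight _) fun x : SymBlocks κ ν R => minorsInd r (x.scaled c)

theorem scaledProb_eq_avg_extendRight [Finite R] (r : ℕ) (c : ℕ) :
    scaledProb κ (π ⊕ ν) R r c = avg fun y : PivotRows κ ν π R => avg fun x : SymBlocks κ ν R =>
      minorsInd r ((SymBlocks.extendRight y x).scaled c) := by
  rw [scaledProb, ← avg_equiv extendRightEquiv, avg_prod]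
  rfl

/-- The κ entries of the new rows already carry their factor c inside `scaled`, so only the
remaining entries `y.1` must be multiplied by c for these rows to join the scaled block. -/
theorem scaledProb_eq_avg_extendLeft [Finite R] (r : ℕ) (c : ℕ) :
    scaledProb (κ ⊕ π) ν R r c = avg fun y : PivotRows κ ν π R => avg fun x : SymBlocks κ ν R =>
      minorsInd r ((SymBlocks.extendRight (c • y.1, y.2) x).scaled c) := by
  rw [scaledProb, ← avg_equiv extendLeftEquiv, avg_prod]
  congr 1
  ext y
  congr 1
  ext x
  refine minorsInd_congr ?_
  rw [← minorsVanish_submatrix_equiv (Equiv.sumAssoc κ π ν)]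
  have : ((SymBlocks.extendRight (c • y.1, y.2) x).scaled c).submatrix (Equiv.sumAssoc κ π ν)
      (Equiv.sumAssoc κ π ν) = (SymBlocks.extendLeft y x).scaled c := by
    ext i j
    rcases i with (i | i) | i <;> rcases j with (j | j) | j <;> rfl
  rw [this]
  rfl

end

section
variable {κ ν ν' R : Type*} [CommRing R]

/-- Two successive rows as a block of two pivot rows. -/
def PivotRows.append (y : PivotRows κ (Unit ⊕ ν) Unit R) (z : PivotRows κ ν Unit R) :
    PivotRows κ ν (Unit ⊕ Unit) R :=
  ((⟨fromBlocks y.1.1.1 y.1.2.toRows₁ᵀ y.1.2.toRows₁ z.1.1.1,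
    Matrix.IsSymm.fromBlocks y.1.1.2 (by simp) z.1.1.2⟩, fromCols y.1.2.toRows₂ z.1.2),
    fromCols y.2 z.2)

variable [Fintype κ] [Fintype ν] [Fintype ν']

theorem minorsInd_extendRight_extendRight (r c : ℕ) (y : PivotRows κ (Unit ⊕ ν) Unit R)
    (z : PivotRows κ ν Unit R) (x : SymBlocks κ ν R) :
    minorsInd r ((SymBlocks.extendRight y (SymBlocks.extendRight z x)).scaled c) =
      minorsInd r ((SymBlocks.extendRight (y.append z) x).scaled c) := by
  refine minorsInd_congr ?_
  rw [← minorsVanish_submatrix_equiv (Equiv.sumCongr (Equiv.refl κ) (Equiv.sumAssoc Unit Unit ν))]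
  have : ((SymBlocks.extendRight y (SymBlocks.extendRight z x)).scaled c).submatrix
      (Equiv.sumCongr (Equiv.refl κ) (Equiv.sumAssoc Unit Unit ν))
      (Equiv.sumCongr (Equiv.refl κ) (Equiv.sumAssoc Unit Unit ν)) =
      (SymBlocks.extendRight (y.append z) x).scaled c := by
    ext i j
    rcases i with i | (i | i) | i <;> rcases j with j | (j | j) | j <;> rfl
  rw [this]

theorem avg_minorsInd_extendRight_congr (f : ν' ≃ ν) (r c : ℕ) (y : PivotRows κ ν Unit R) :
    (avg fun x : SymBlocks κ ν R => minorsInd r ((SymBlocks.extendRight y x).scaled c)) =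
    avg fun x : SymBlocks κ ν' R => minorsInd r
      ((SymBlocks.extendRight ((y.1.1, y.1.2.submatrix f id), y.2) x).scaled c) := by
  rw [← avg_equiv (symBlocksCongr (Equiv.refl κ) f)]
  congr 1
  ext x
  refine minorsInd_congr ?_
  rw [← minorsVanish_submatrix_equiv
    (Equiv.sumCongr (Equiv.refl κ) (Equiv.sumCongr (Equiv.refl Unit) f))
    ((SymBlocks.extendRight y x).scaled c)]
  have : ((SymBlocks.extendRight y x).scaled c).submatrix
      (Equiv.sumCongr (Equiv.refl κ) (Equiv.sumCongr (Equiv.refl Unit) f))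
      (Equiv.sumCongr (Equiv.refl κ) (Equiv.sumCongr (Equiv.refl Unit) f)) =
      (SymBlocks.extendRight ((y.1.1, y.1.2.submatrix f id), y.2)
        (symBlocksCongr (Equiv.refl κ) f x)).scaled c := by
    ext i j
    rcases i with i | i | i <;> rcases j with j | j | j <;> rfl
  rw [this]

/-- If the first row makes the 2 × 2 pivot invertible for every choice of the second, the second row
can be averaged out. -/
theorem avg_minorsInd_of_isUnit_append [Finite R] (r c : ℕ) (y : PivotRows κ (Unit ⊕ ν) Unit R)
    (h : ∀ z : PivotRows κ ν Unit R, IsUnit (y.append z).1.1.1.det) :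
    (avg fun x : SymBlocks κ (Unit ⊕ ν) R => minorsInd r ((SymBlocks.extendRight y x).scaled c)) =
      scaledProb κ ν R r c := by
  rw [← avg_equiv extendRightEquiv, avg_prod]
  have : ∀ z : PivotRows κ ν Unit R, (avg fun x : SymBlocks κ ν R =>
      minorsInd r ((SymBlocks.extendRight y (extendRightEquiv (z, x))).scaled c)) =
      scaledProb κ ν R r c := by
    intro z
    rw [← avg_minorsInd_extendRight r c (y.append z) (h z)]
    congr 1
    ext x
    exact minorsInd_extendRight_extendRight r c y z x
  simp only [this]
  exact avg_const _
end

/-! ### Revealing one row -/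

theorem det_fromBlocks_unit {R : Type*} [CommRing R] (A B C D : Matrix Unit Unit R) :
    (fromBlocks A B C D).det = A () () * D () () - B () () * C () () := by
  let e : Fin 2 ≃ Unit ⊕ Unit :=
    { toFun := ![Sum.inl (), Sum.inr ()]
      invFun := Sum.elim (fun _ => 0) fun _ => 1
      left_inv := by decide
      right_inv := by decide }
  rw [← Matrix.det_submatrix_equiv_self e, Matrix.det_fin_two]
  simp [e]

theorem exists_equiv_unit_sum_fin {n : ℕ} (i : Fin (n + 1)) :
    ∃ f : Unit ⊕ Fin n ≃ Fin (n + 1), f (Sum.inl ()) = i :=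
  ⟨(Equiv.sumComm _ _).trans ((Equiv.optionEquivSumPUnit (Fin n)).symm.trans
    (finSuccEquiv' i).symm), by simp⟩

section
variable {κ R K : Type*} [CommRing R] [Field K] [Fintype κ] {n : ℕ}

/-- Reduction of the entries of a row. -/
def reduceRow (red : R →+* K) (n : ℕ) :
    symMats Unit R × Matrix (Fin n) Unit R →+ K × (Fin n → K) where
  toFun y := (red (y.1.1 () ()), fun i => red (y.2 i ()))
  map_zero' := by
    ext <;> simp
  map_add' y z := by
    ext <;> simp

variable {red : R →+* K}

theorem reduceRow_surjective (hs : Function.Surjective red) (n : ℕ) :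
    Function.Surjective (reduceRow red n) := by
  rintro ⟨a, v⟩
  obtain ⟨a, rfl⟩ := hs a
  choose w hw using fun i => hs (v i)
  refine ⟨(⟨Matrix.of fun _ _ => a, by ext; rfl⟩, Matrix.of fun i _ => w i), ?_⟩
  simp [reduceRow, hw]

variable {c : ℕ} (hunit : ∀ x, IsUnit x ↔ red x ≠ 0) (hker : ∀ x, red x = 0 ↔ ∃ y, x = c * y)

-- Move the unit off-diagonal entry b next to the pivot. Since the first diagonal entry reduces to
-- 0, the 2 × 2 determinant reduces to -b², whatever the second diagonal entry is.
include hunit in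
theorem avg_minorsInd_extendRight_of_ne [Finite R] (r : ℕ) (y : PivotRows κ (Fin n) Unit R)
    (h1 : (reduceRow red n y.1).1 = 0) (h2 : reduceRow red n y.1 ≠ 0) :
    (avg fun x : SymBlocks κ (Fin n) R => minorsInd r ((SymBlocks.extendRight y x).scaled c)) =
      scaledProb κ (Fin (n - 1)) R r c := by
  have h3 : ∃ i, red (y.1.2 i ()) ≠ 0 := by
    by_contra! h
    exact h2 (Prod.ext h1 (funext h))
  obtain ⟨i, hi⟩ := h3
  cases n with
  | zero => exact i.elim0
  | succ n =>
    obtain ⟨f, rfl⟩ := exists_equiv_unit_sum_fin i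
    rw [avg_minorsInd_extendRight_congr f, avg_minorsInd_of_isUnit_append]
    · rfl
    · intro z
      change IsUnit (fromBlocks _ _ _ _).det
      have h1' : red (y.1.1.1 () ()) = 0 := h1
      rw [det_fromBlocks_unit, hunit]
      simp [h1', hi]

include hker in
theorem mem_range_nsmul_iff (y : symMats Unit R × Matrix (Fin n) Unit R) :
    y ∈ (nsmulAddMonoidHom (α := symMats Unit R × Matrix (Fin n) Unit R) c).range ↔
      reduceRow red n y = 0 := by
  constructor
  · rintro ⟨z, rfl⟩
    have hc : (c : K) = 0 := by
      simpa using (hker c).2 ⟨1, by simp⟩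
    ext <;> simp [reduceRow, hc]
  · intro h
    obtain ⟨a, ha⟩ := (hker (y.1.1 () ())).1 (congr_arg Prod.fst h)
    choose w hw using fun i => (hker (y.2 i ())).1 (congr_fun (congr_arg Prod.snd h) i)
    refine ⟨(⟨Matrix.of fun _ _ => a, by ext; rfl⟩, Matrix.of fun i _ => w i), ?_⟩
    ext i
    · simp [ha]
    · simp [hw]

-- The three terms are the cases of a unit diagonal entry, a 2 × 2 pivot, and a row whose n + 1
-- unscaled entries all reduce to zero.
include hunit hker in
theorem scaledProb_unit_sum [Finite R] [Finite K] (hs : Function.Surjective red) (r : ℕ) :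
    scaledProb κ (Unit ⊕ Fin n) R r c =
      (1 - (Nat.card K : ℝ)⁻¹) * scaledProb κ (Fin n) R r c +
      ((Nat.card K : ℝ)⁻¹ - (Nat.card K : ℝ)⁻¹ ^ (n + 1)) * scaledProb κ (Fin (n - 1)) R r c +
      (Nat.card K : ℝ)⁻¹ ^ (n + 1) * scaledProb (κ ⊕ Unit) (Fin n) R r c := by
  classical
  set Φ : symMats Unit R × Matrix (Fin n) Unit R → ℝ := fun y => avg fun b : Matrix κ Unit R =>
    avg fun x : SymBlocks κ (Fin n) R => minorsInd r ((SymBlocks.extendRight (y, b) x).scaled c)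
    with hΦ
  set T₁ := scaledProb κ (Fin n) R r c
  set T₂ := scaledProb κ (Fin (n - 1)) R r c
  -- The three cases are written through indicators of nested events, so that averaging is linear.
  have hpt : ∀ y, Φ y = T₁ + ((T₂ - T₁) * (if (reduceRow red n y).1 = 0 then 1 else 0) +
      (-T₂ * (if reduceRow red n y = 0 then 1 else 0) +
      (if y ∈ (nsmulAddMonoidHom (α := symMats Unit R × Matrix (Fin n) Unit R) c).range
        then Φ y else 0))) := by
    intro y
    simp only [mem_range_nsmul_iff hker]
    by_cases h0 : reduceRow red n y = 0
    · simp only [h0, if_true, Prod.fst_zero]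
      ring
    · by_cases h1 : (reduceRow red n y).1 = 0
      · simp only [h0, h1, if_true, if_false]
        have : Φ y = T₂ := by
          simp only [hΦ]
          rw [← avg_const (α := Matrix κ Unit R) T₂]
          congr 1
          ext b
          exact avg_minorsInd_extendRight_of_ne hunit r (y, b) h1 h0
        rw [this]
        ring
      · simp only [h0, h1, if_false]
        have : Φ y = T₁ := by
          simp only [hΦ]
          rw [← avg_const (α := Matrix κ Unit R) T₁]
          congr 1
          ext b
          refine avg_minorsInd_extendRight r c (y, b) ?_
          rw [Matrix.det_unique, hunit]
          exact h1
        rw [this]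
        ring
  have e1 : avg (fun y => if (reduceRow red n y).1 = 0 then (1 : ℝ) else 0) =
      (Nat.card K : ℝ)⁻¹ := by
    have := avg_comp_surjective ((AddMonoidHom.fst _ _).comp (reduceRow red n))
      (Prod.fst_surjective.comp (reduceRow_surjective hs n)) (fun x => if x = 0 then (1 : ℝ) else 0)
    rw [avg_singleton, one_div] at this
    exact this
  have e2 : avg (fun y => if reduceRow red n y = 0 then (1 : ℝ) else 0) =
      (Nat.card K : ℝ)⁻¹ ^ (n + 1) := by
    have := avg_comp_surjective (reduceRow red n) (reduceRow_surjective hs n)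
      (fun x => if x = 0 then (1 : ℝ) else 0)
    rw [avg_singleton, one_div, Nat.card_prod, Nat.card_fun, Nat.card_fin] at this
    rw [this, inv_pow, pow_succ']
    push_cast
    rfl
  have e3 : (avg fun y => if y ∈ (nsmulAddMonoidHom
      (α := symMats Unit R × Matrix (Fin n) Unit R) c).range then Φ y else 0) =
      (Nat.card K : ℝ)⁻¹ ^ (n + 1) * scaledProb (κ ⊕ Unit) (Fin n) R r c := by
    rw [avg_range_addMonoidHom, scaledProb_eq_avg_extendLeft]
    simp only [mem_range_nsmul_iff hker, e2]
    congr 1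
    exact (avg_prod fun y : PivotRows κ (Fin n) Unit R => avg fun x : SymBlocks κ (Fin n) R =>
      minorsInd r ((SymBlocks.extendRight (c • y.1, y.2) x).scaled c)).symm
  have hS : scaledProb κ (Unit ⊕ Fin n) R r c = avg Φ := by
    rw [scaledProb_eq_avg_extendRight, avg_prod]
  rw [hS, show Φ = _ from funext hpt, avg_add, avg_add, avg_add, avg_const, avg_const_mul,
    avg_const_mul, e1, e2, e3]
  ring

end

/-! ### Exhausting the rows over ℤ/p^s -/

section
variable {κ ν R : Type*} [CommRing R] [Finite R] [Fintype κ] [Fintype ν]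

theorem scaledProb_of_isEmpty_left [IsEmpty κ] (r c : ℕ) :
    scaledProb κ ν R r c = avg fun A : symMats ν R => minorsInd r A.1 := by
  rw [scaledProb, avg_prod, ← avg_const (α := symMats κ R) (avg fun A : symMats ν R => _)]
  congr 1
  ext C
  rw [avg_prod, ← avg_const (α := Matrix κ ν R) (avg fun A : symMats ν R => _)]
  congr 1
  ext B
  congr 1
  ext A
  refine minorsInd_congr ?_
  rw [← minorsVanish_submatrix_equiv (Equiv.emptySum κ ν) A.1]
  have : A.1.submatrix (Equiv.emptySum κ ν) (Equiv.emptySum κ ν) =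
      SymBlocks.scaled c (C, B, A) := by
    ext i j
    rcases i with i | i
    · exact isEmptyElim i
    rcases j with j | j
    · exact isEmptyElim j
    rfl
  rw [this]

theorem scaledProb_of_isEmpty_right [IsEmpty ν] (r c : ℕ) :
    scaledProb κ ν R r c = avg fun C : symMats κ R => minorsInd r (c • C.1) := by
  rw [scaledProb, avg_prod]
  congr 1
  ext C
  rw [← avg_const (α := Matrix κ ν R × symMats ν R) (minorsInd r _)]
  congr 1
  ext ⟨B, A⟩
  refine minorsInd_congr ?_
  rw [← minorsVanish_submatrix_equiv (Equiv.sumEmpty κ ν) (c • C.1)]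
  have : (c • C.1).submatrix (Equiv.sumEmpty κ ν) (Equiv.sumEmpty κ ν) =
      SymBlocks.scaled c (C, B, A) := by
    ext i j
    rcases i with i | i
    swap
    · exact isEmptyElim i
    rcases j with j | j
    swap
    · exact isEmptyElim j
    rfl
  rw [this]
end

section
variable (p : ℕ) [hp : Fact p.Prime]


/-- Probability that a random symmetric `n × n` matrix over `ℤ/p^s` has determinantal rank at most
`n - r`. -/
noncomputable def symProb (r n s : ℕ) : ℝ :=
  avg fun A : symMats (Fin n) (ZMod (p ^ s)) => minorsInd r A.1

/-- The same probability for a random symmetric matrix of size `k + n` whose first `k` rows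
and columns are scaled by `p`. -/
noncomputable def symProbScaled (r s k n : ℕ) : ℝ :=
  scaledProb (Fin k) (Fin n) (ZMod (p ^ s)) r p

theorem symProbScaled_zero_left (r s n : ℕ) : symProbScaled p r s 0 n = symProb p r n s :=
  scaledProb_of_isEmpty_left r p

theorem minorsInd_nonneg {ι R : Type*} [CommRing R] [Fintype ι] (r : ℕ) (A : Matrix ι ι R) :
    0 ≤ minorsInd r A := by
  unfold minorsInd
  split_ifs <;> norm_num

theorem symProb_nonneg (r n s : ℕ) : 0 ≤ symProb p r n s := avg_nonneg fun _ => minorsInd_nonneg _ _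

omit hp in
theorem symProb_zero_right (r n : ℕ) : symProb p r n 0 = 1 := by
  have : Subsingleton (ZMod (p ^ 0)) := by
    rw [pow_zero]
    infer_instance
  have h : ∀ A : symMats (Fin n) (ZMod (p ^ 0)), minorsInd r A.1 = 1 := fun A =>
    if_pos (minorsVanish_of_subsingleton A.1)
  simp only [symProb, h]
  exact avg_const 1

theorem isUnit_zmod_prime_pow_iff {s : ℕ} (hs : s ≠ 0) (x : ZMod (p ^ s)) :
    IsUnit x ↔ ZMod.castHom (dvd_pow_self p hs) (ZMod p) x ≠ 0 := by
  obtain ⟨a, rfl⟩ := ZMod.natCast_zmod_surjective x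
  rw [ZMod.isUnit_iff_coprime, map_natCast, Ne, ZMod.natCast_eq_zero_iff,
    Nat.coprime_pow_right_iff (Nat.pos_of_ne_zero hs), Nat.coprime_comm,
    hp.out.coprime_iff_not_dvd]

theorem castHom_eq_zero_iff {s : ℕ} (hs : s ≠ 0) (x : ZMod (p ^ s)) :
    ZMod.castHom (dvd_pow_self p hs) (ZMod p) x = 0 ↔ ∃ y, x = p * y := by
  constructor
  · obtain ⟨a, rfl⟩ := ZMod.natCast_zmod_surjective x
    rw [map_natCast, ZMod.natCast_eq_zero_iff]
    rintro ⟨b, rfl⟩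
    exact ⟨b, by push_cast; rfl⟩
  · rintro ⟨y, rfl⟩
    rw [map_mul, map_natCast, ZMod.natCast_self, zero_mul]

/-- For n = 0 the truncated n - 1 is harmless: its coefficient is zero. -/
theorem symProbScaled_succ (r k n : ℕ) {s : ℕ} (hs : s ≠ 0) :
    symProbScaled p r s k (n + 1) = (1 - (p : ℝ)⁻¹) * symProbScaled p r s k n +
      ((p : ℝ)⁻¹ - (p : ℝ)⁻¹ ^ (n + 1)) * symProbScaled p r s k (n - 1) +
      (p : ℝ)⁻¹ ^ (n + 1) * symProbScaled p r s (k + 1) n := by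
  obtain ⟨f, -⟩ := exists_equiv_unit_sum_fin (n := n) 0
  obtain ⟨g, -⟩ := exists_equiv_unit_sum_fin (n := k) 0
  have := scaledProb_unit_sum (κ := Fin k) (n := n) (isUnit_zmod_prime_pow_iff p hs)
    (castHom_eq_zero_iff p hs) (ZMod.castHom_surjective _) r
  rw [scaledProb_congr (Equiv.refl (Fin k)) f, Nat.card_zmod,
    scaledProb_congr ((Equiv.sumComm _ _).trans g) (Equiv.refl (Fin n))] at this
  exact this

/-- By Laplace expansion it suffices to treat the minors of the least size k + 1 - r, which scale by
p^(k+1-r). If this exponent exceeds s, the target ring is ℤ/p^0 = ℤ/1, where everything vanishes. -/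
theorem minorsVanish_smul_iff {k r s : ℕ} (hk : r ≤ k)
    (C : Matrix (Fin k) (Fin k) (ZMod (p ^ s))) :
    MinorsVanish r (p • C) ↔
      MinorsVanish r (C.map (ZMod.castHom (pow_dvd_pow p (Nat.sub_le s (k + 1 - r)))
        (ZMod (p ^ (s - (k + 1 - r)))))) := by
  have key : ∀ (j : ℕ) (x : ZMod (p ^ s)), (p : ZMod (p ^ s)) ^ j * x = 0 ↔
      ZMod.castHom (pow_dvd_pow p (Nat.sub_le s j)) (ZMod (p ^ (s - j))) x = 0 := by
    intro j x
    obtain ⟨a, rfl⟩ := ZMod.natCast_zmod_surjective x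
    rw [map_natCast, ZMod.natCast_eq_zero_iff, ← Nat.cast_pow, ← Nat.cast_mul,
      ZMod.natCast_eq_zero_iff]
    rcases le_total j s with h | h
    · obtain ⟨d, rfl⟩ := Nat.exists_eq_add_of_le h
      rw [pow_add, Nat.mul_dvd_mul_iff_left (pow_pos hp.out.pos _)]
      simp
    · simp [Nat.sub_eq_zero_of_le h, (pow_dvd_pow p h).mul_right a]
  have hdet : ∀ {j : ℕ} (f g : Fin j → Fin k), ((p • C).submatrix f g).det =
      (p : ZMod (p ^ s)) ^ j * (C.submatrix f g).det := by
    intro j f g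
    have : (p • C).submatrix f g = (p : ZMod (p ^ s)) • C.submatrix f g := by
      rw [← Nat.cast_smul_eq_nsmul (ZMod (p ^ s)) p C]
      rfl
    rw [this, Matrix.det_smul, Fintype.card_fin]
  have hmap : ∀ {j : ℕ} (f g : Fin j → Fin k), ∀ φ : ZMod (p ^ s) →+* ZMod (p ^ (s - (k + 1 - r))),
      ((C.map φ).submatrix f g).det = φ (C.submatrix f g).det := by
    intro j f g φ
    rw [RingHom.map_det]
    rfl
  constructor
  · intro h j f g hj
    rw [Fintype.card_fin] at hj
    refine minors_eq_zero_of_le (show k + 1 - r ≤ j by omega) (fun f g => ?_) f g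
    have := h _ f g (by rw [Fintype.card_fin]; omega)
    rw [hdet, key] at this
    rw [hmap, this]
  · intro h j f g hj
    have := h j f g hj
    rw [Fintype.card_fin] at hj
    rw [hmap, ← key] at this
    rw [hdet, ← pow_sub_mul_pow (p : ZMod (p ^ s)) (show k + 1 - r ≤ j by omega), mul_assoc, this,
      mul_zero]

theorem symProbScaled_zero_right {r s k : ℕ} (hk : r ≤ k) :
    symProbScaled p r s k 0 = symProb p r k (s - (k + 1 - r)) := by
  rw [symProbScaled, scaledProb_of_isEmpty_right, symProb]
  set φ := ZMod.castHom (pow_dvd_pow p (Nat.sub_le s (k + 1 - r))) (ZMod (p ^ (s - (k + 1 - r))))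
    with hφ
  let ψ : symMats (Fin k) (ZMod (p ^ s)) →+ symMats (Fin k) (ZMod (p ^ (s - (k + 1 - r)))) :=
    { toFun := fun A => ⟨A.1.map φ, Matrix.IsSymm.map A.2 φ⟩
      map_zero' := by ext; simp
      map_add' := fun A B => by ext; simp }
  have hψ : Function.Surjective ψ := by
    intro B
    obtain ⟨σ, hσ⟩ := (ZMod.castHom_surjective (pow_dvd_pow p (Nat.sub_le s (k + 1 - r)))).hasRightInverse
    refine ⟨⟨B.1.map σ, Matrix.IsSymm.map B.2 σ⟩, ?_⟩
    ext i j
    exact hσ _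
  rw [← avg_comp_surjective ψ hψ]
  congr 1
  ext C
  exact minorsInd_congr (minorsVanish_smul_iff p hk C.1)

theorem symProbScaled_zero_right_of_lt {r s k : ℕ} (hs : s ≠ 0) (hk : k < r) :
    symProbScaled p r s k 0 = 0 := by
  have : Fact (1 < p ^ s) := ⟨Nat.one_lt_pow hs hp.out.one_lt⟩
  have h : ∀ C : symMats (Fin k) (ZMod (p ^ s)), minorsInd r (p • C.1) = 0 := fun C =>
    if_neg (not_minorsVanish _ (by rwa [Fintype.card_fin]))
  rw [symProbScaled, scaledProb_of_isEmpty_right]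
  simp only [h]
  exact avg_const 0
end

/-! ### The corank law and the closed recursion -/

/-- The law of the corank of a random symmetric `n × n` matrix over the field with `q⁻¹`
elements. -/
noncomputable def corankProb (q : ℝ) : ℕ → ℕ → ℝ
  | 0, 0 => 1
  | 0, _ + 1 => 0
  | 1, 0 => 1 - q
  | 1, 1 => q
  | 1, _ + 2 => 0
  | n + 2, 0 => (1 - q) * corankProb q (n + 1) 0 + (q - q ^ (n + 2)) * corankProb q n 0
  | n + 2, k + 1 => (1 - q) * corankProb q (n + 1) (k + 1) +
      (q - q ^ (n + 2)) * corankProb q n (k + 1) + q ^ (n + 2) * corankProb q (n + 1) k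

theorem corankProb_eq_zero (q : ℝ) : ∀ {n k : ℕ}, n < k → corankProb q n k = 0
  | 0, _ + 1, _ => by rw [corankProb]
  | 1, 0, h => by omega
  | 1, 1, h => by omega
  | 1, _ + 2, _ => by rw [corankProb]
  | n + 2, 0, h => by omega
  | n + 2, k + 1, h => by
    rw [corankProb, corankProb_eq_zero q (by omega : n + 1 < k + 1),
      corankProb_eq_zero q (by omega : n < k + 1), corankProb_eq_zero q (by omega : n + 1 < k)]
    ring

theorem sum_corankProb_succ_succ (q : ℝ) (n : ℕ) (a : ℕ → ℝ) :
    ∑ k ∈ Finset.range (n + 3), corankProb q (n + 2) k * a k =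
      (1 - q) * ∑ k ∈ Finset.range (n + 2), corankProb q (n + 1) k * a k +
      (q - q ^ (n + 2)) * ∑ k ∈ Finset.range (n + 1), corankProb q n k * a k +
      q ^ (n + 2) * ∑ k ∈ Finset.range (n + 2), corankProb q (n + 1) k * a (k + 1) := by
  have h1 : ∑ k ∈ Finset.range (n + 2), corankProb q (n + 1) k * a k =
      ∑ k ∈ Finset.range (n + 2), corankProb q (n + 1) (k + 1) * a (k + 1) +
        corankProb q (n + 1) 0 * a 0 := by
    rw [← Finset.sum_range_succ' (fun k => corankProb q (n + 1) k * a k), Finset.sum_range_succ _ (n + 2),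
      corankProb_eq_zero q (by omega : n + 1 < n + 2)]
    ring
  have h2 : ∑ k ∈ Finset.range (n + 1), corankProb q n k * a k =
      ∑ k ∈ Finset.range (n + 2), corankProb q n (k + 1) * a (k + 1) +
        corankProb q n 0 * a 0 := by
    rw [← Finset.sum_range_succ' (fun k => corankProb q n k * a k), Finset.sum_range_succ _ (n + 2),
      Finset.sum_range_succ _ (n + 1),
      corankProb_eq_zero q (by omega : n < n + 2), corankProb_eq_zero q (by omega : n < n + 1)]
    ring
  rw [Finset.sum_range_succ', h1, h2]
  simp only [corankProb, add_mul, Finset.sum_add_distrib, mul_assoc, ← Finset.mul_sum]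
  ring

section
variable (p : ℕ) [hp : Fact p.Prime]

/-- `corankProb` obeys the same linear row recursion, with i counting the rows that join the scaled
block. -/
theorem symProbScaled_eq_sum (r : ℕ) {s : ℕ} (hs : s ≠ 0) : ∀ n k : ℕ, symProbScaled p r s k n =
    ∑ i ∈ Finset.range (n + 1), corankProb (p : ℝ)⁻¹ n i * symProbScaled p r s (k + i) 0
  | 0, k => by simp [corankProb]
  | 1, k => by
    rw [symProbScaled_succ p r k 0 hs]
    simp [Finset.sum_range_succ, corankProb]
  | n + 2, k => by
    rw [symProbScaled_succ p r k (n + 1) hs, symProbScaled_eq_sum r hs (n + 1),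
      Nat.add_sub_cancel, symProbScaled_eq_sum r hs n, symProbScaled_eq_sum r hs (n + 1),
      sum_corankProb_succ_succ]
    simp only [add_assoc, add_comm 1]

/-- Coranks k < r contribute nothing, as the empty minor is already nonzero. -/
theorem symProb_eq_sum (r : ℕ) {s : ℕ} (hs : s ≠ 0) (n : ℕ) : symProb p r n s =
    ∑ k ∈ Finset.Ico r (n + 1), corankProb (p : ℝ)⁻¹ n k * symProb p r k (s - (k + 1 - r)) := by
  rw [← symProbScaled_zero_left, symProbScaled_eq_sum p r hs, Finset.range_eq_Ico,
    ← Finset.sum_subset (Finset.Ico_subset_Ico_left (Nat.zero_le r))]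
  · refine Finset.sum_congr rfl fun k hk => ?_
    rw [zero_add, symProbScaled_zero_right p (Finset.mem_Ico.1 hk).1]
  · intro k hk hk'
    rw [zero_add, symProbScaled_zero_right_of_lt p hs, mul_zero]
    simp only [Finset.mem_Ico] at hk hk'
    omega
end

/-! ### From the entry law to averages over symmetric matrices -/

theorem symMatrix_injective {R : Type*} {n : ℕ} :
    Function.Injective (symMatrix : (Sym2 (Fin n) → R) → _) := by
  intro x y h
  ext z
  induction z with
  | _ i j => exact congr_fun (congr_fun h i) j

/-- The symmetric matrix with given free entries. -/
noncomputable def symMatrixEquiv (R : Type*) [CommRing R] (n : ℕ) :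
    (Sym2 (Fin n) → R) ≃ symMats (Fin n) R :=
  Equiv.ofBijective (fun x => ⟨symMatrix x, symMatrix_isSymm x⟩)
    ⟨fun x y h => symMatrix_injective (congr_arg Subtype.val h), fun A => by
      refine ⟨Sym2.lift ⟨fun i j => A.1 i j, fun i j => (congr_fun (congr_fun A.2 i) j).symm⟩, ?_⟩
      ext i j
      simp [symMatrix]⟩

open Classical in
theorem entryLaw_real_eq_avg (q n : ℕ) [NeZero q] (S : Set (Sym2 (Fin n) → ZMod q)) :
    (entryLaw q n).real S = avg fun x => if x ∈ S then (1 : ℝ) else 0 := by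
  have h1 : ∀ x, (entryLaw q n).real {x} = ((Fintype.card (Sym2 (Fin n) → ZMod q) : ℕ) : ℝ)⁻¹ := by
    intro x
    have : IsProbabilityMeasure (uniformOn (Set.univ : Set (ZMod q))) :=
      isProbabilityMeasure_uniformOn Set.finite_univ Set.univ_nonempty
    rw [measureReal_def, entryLaw, Measure.pi_singleton]
    simp [uniformOn_univ, ENNReal.toReal_inv]
  rw [avg_eq_sum, ← Set.toFinite S |>.coe_toFinset, ← sum_measureReal_singleton]
  simp [h1, div_eq_mul_inv]

theorem probRankLe_eq_symProb (p : ℕ) [hp : Fact p.Prime] {m : ℕ} (hm : m ≠ 0) (n r : ℕ) :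
    probRankLe p m n r = symProb p r n m := by
  have : Fact (1 < p ^ m) := ⟨Nat.one_lt_pow hm hp.out.one_lt⟩
  rw [probRankLe, entryLaw_real_eq_avg, symProb, ← avg_equiv (symMatrixEquiv _ n)]
  congr 1
  ext x
  rw [minorsInd]
  congr 1
  rw [Set.mem_ofPred_eq, ← minorsVanish_iff_detRank_le]
  rfl

/-! ### Triangular numbers and bounds for the corank law -/

/-- The triangular numbers. -/
def tri (k : ℕ) : ℕ := k * (k + 1) / 2

theorem two_mul_tri (k : ℕ) : 2 * tri k = k * (k + 1) :=
  Nat.mul_div_cancel' (Nat.even_mul_succ_self k).two_dvd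

theorem tri_succ (k : ℕ) : tri (k + 1) = tri k + (k + 1) := by
  have h1 := two_mul_tri k
  have h2 := two_mul_tri (k + 1)
  nlinarith

section
variable {q : ℝ} (hq : 0 < q) (hq3 : q ≤ 1 / 3)
include hq hq3

theorem sub_pow_nonneg (n : ℕ) : 0 ≤ q - q ^ (n + 1) := by
  have : q ^ (n + 1) ≤ q := pow_le_of_le_one hq.le (by linarith) (by omega)
  linarith

theorem corankProb_nonneg : ∀ n k : ℕ, 0 ≤ corankProb q n k
  | 0, 0 => by simp [corankProb]
  | 0, _ + 1 => by simp [corankProb]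
  | 1, 0 => by rw [corankProb]; linarith
  | 1, 1 => by rw [corankProb]; exact hq.le
  | 1, _ + 2 => by simp [corankProb]
  | n + 2, 0 => by
    rw [corankProb]
    have h1 := corankProb_nonneg (n + 1) 0
    have h2 := corankProb_nonneg n 0
    have h3 := sub_pow_nonneg hq hq3 (n + 1)
    have h4 : 0 ≤ 1 - q := by linarith
    positivity
  | n + 2, k + 1 => by
    rw [corankProb]
    have h1 := corankProb_nonneg (n + 1) (k + 1)
    have h2 := corankProb_nonneg n (k + 1)
    have h5 := corankProb_nonneg (n + 1) k
    have h3 := sub_pow_nonneg hq hq3 (n + 1)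
    have h4 : 0 ≤ 1 - q := by linarith
    positivity

omit hq hq3 in
theorem corankProb_self : ∀ n : ℕ, corankProb q n n = q ^ tri n
  | 0 => by simp [corankProb, tri]
  | 1 => by simp [corankProb, tri]
  | n + 2 => by
    rw [corankProb, corankProb_eq_zero q (by omega : n + 1 < n + 1 + 1),
      corankProb_eq_zero q (by omega : n < n + 1 + 1), corankProb_self (n + 1), tri_succ (n + 1)]
    ring

/-- The correction q^(n-k) strengthens the bound 2 q^(tri k) so that the induction closes. -/
theorem corankProb_le : ∀ n k : ℕ, corankProb q n k ≤ (2 - q ^ (n - k)) * q ^ tri k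
  | 0, 0 => by norm_num [corankProb, tri]
  | 0, k + 1 => by
    have : 0 < q ^ tri (k + 1) := by positivity
    norm_num [corankProb]
    exact this.le
  | 1, 0 => by norm_num [corankProb, tri]
  | 1, 1 => by norm_num [corankProb, tri]
  | 1, k + 2 => by
    have : 0 < q ^ tri (k + 2) := by positivity
    norm_num [corankProb]
    exact this.le
  | n + 2, 0 => by
    rw [corankProb]
    have h1 := corankProb_le (n + 1) 0
    have h2 := corankProb_le n 0
    simp only [Nat.sub_zero, show tri 0 = 0 from rfl, pow_zero, mul_one] at h1 h2 ⊢
    have h3 := sub_pow_nonneg hq hq3 (n + 1)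
    have hx : 0 < q ^ n := by positivity
    have hx1 : q ^ n ≤ 1 := pow_le_one₀ hq.le (by linarith)
    have h4 := mul_le_mul_of_nonneg_left h1 (by linarith : 0 ≤ 1 - q)
    have h5 := mul_le_mul_of_nonneg_left h2 h3
    simp only [pow_succ] at h4 h5 ⊢
    nlinarith [mul_pos hq hx, mul_pos hq (mul_pos hq hx), mul_nonneg (mul_pos hq (mul_pos hq hx)).le (sub_nonneg.2 hx1)]
  | n + 2, k + 1 => by
    rcases lt_or_ge (n + 2) (k + 1) with h | h
    · rw [corankProb_eq_zero q h, Nat.sub_eq_zero_of_le h.le]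
      have : 0 < q ^ tri (k + 1) := by positivity
      norm_num
      exact this.le
    rcases h.eq_or_lt with h | h
    · rw [← h, corankProb_self, Nat.sub_self]
      norm_num
    rw [corankProb]
    have h1 := corankProb_le (n + 1) (k + 1)
    have h2 := corankProb_le n (k + 1)
    have h5 := corankProb_le (n + 1) k
    have h3 := sub_pow_nonneg hq hq3 (n + 1)
    obtain ⟨d, rfl⟩ := Nat.exists_eq_add_of_le (show k ≤ n by omega)
    have e1 : k + d + 1 - (k + 1) = d := by omega
    have e2 : k + d + 1 - k = d + 1 := by omega
    have e3 : k + d + 2 - (k + 1) = d + 1 := by omega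
    rw [e1] at h1
    rw [e2] at h5
    rw [e3]
    set T := q ^ tri (k + 1) with hT
    have hTpos : 0 < T := by positivity
    have hT' : q ^ (k + d + 2) * q ^ tri k = q ^ (d + 1) * T := by
      rw [hT, tri_succ]
      ring
    have h6 : q ^ (k + d + 2) * corankProb q (k + d + 1) k ≤
        (2 - q ^ (d + 1)) * q ^ (d + 1) * T := by
      have := mul_le_mul_of_nonneg_left h5 (by positivity : 0 ≤ q ^ (k + d + 2))
      calc _ ≤ _ := this
        _ = (2 - q ^ (d + 1)) * (q ^ (k + d + 2) * q ^ tri k) := by ring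
        _ = _ := by rw [hT']; ring
    have h4 := mul_le_mul_of_nonneg_left h1 (by linarith : 0 ≤ 1 - q)
    have h7 : (q - q ^ (k + d + 2)) * corankProb q (k + d) (k + 1) ≤
        q * ((2 - q ^ (d - 1)) * T) := by
      refine (mul_le_mul_of_nonneg_left h2 h3).trans ?_
      rw [show k + d - (k + 1) = d - 1 by omega]
      refine mul_le_mul_of_nonneg_right (by linarith [pow_pos hq (k + d + 2)]) ?_
      have := pow_le_one₀ (n := d - 1) hq.le (by linarith)
      exact mul_nonneg (by linarith) hTpos.le
    refine (add_le_add (add_le_add h4 h7) h6).trans ?_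
    have key : (1 - q) * (2 - q ^ d) + q * (2 - q ^ (d - 1)) + (2 - q ^ (d + 1)) * q ^ (d + 1) ≤
        2 - q ^ (d + 1) := by
      cases d with
      | zero => norm_num; nlinarith
      | succ d =>
        have hx : 0 < q ^ d := by positivity
        rw [Nat.add_sub_cancel, pow_succ q (d + 1), pow_succ q d]
        nlinarith [mul_pos hq hx, mul_pos hq (mul_pos hq hx),
          mul_nonneg (mul_pos hq hx).le (sub_nonneg.2 hq3), sq_nonneg (q ^ d * q * q)]
    nlinarith [mul_le_mul_of_nonneg_right key hTpos.le]

theorem corankProb_le_two_mul (n k : ℕ) : corankProb q n k ≤ 2 * q ^ tri k := by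
  refine (corankProb_le hq hq3 n k).trans (mul_le_mul_of_nonneg_right ?_ (by positivity))
  linarith [pow_pos hq (n - k)]

/-- The extra q^n / 2 is again what lets the induction close; only the bound 1/2 is used later. -/
theorem le_corankProb_zero : ∀ n : ℕ, (1 + q ^ n) / 2 ≤ corankProb q n 0
  | 0 => by norm_num [corankProb]
  | 1 => by rw [corankProb]; linarith
  | n + 2 => by
    rw [corankProb]
    have h1 := mul_le_mul_of_nonneg_left (le_corankProb_zero (n + 1)) (by linarith : 0 ≤ 1 - q)
    have h2 := mul_le_mul_of_nonneg_left (le_corankProb_zero n) (sub_pow_nonneg hq hq3 (n + 1))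
    have hx : 0 < q ^ n := by positivity
    have hx1 : q ^ n ≤ 1 := pow_le_one₀ hq.le (by linarith)
    simp only [pow_succ] at h1 h2 ⊢
    nlinarith [mul_pos hq hx, mul_pos hq (mul_pos hq hx), mul_nonneg (mul_pos hq hx).le (sub_nonneg.2 hq3), mul_nonneg (mul_pos hq (mul_pos hq hx)).le (sub_nonneg.2 hx1)]

theorem half_mul_le_corankProb : ∀ {n k : ℕ}, k ≤ n → 1 / 2 * q ^ tri k ≤ corankProb q n k
  | n, 0, _ => by
    have := le_corankProb_zero hq hq3 n
    have := pow_pos hq n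
    simp only [show tri 0 = 0 from rfl, pow_zero]
    linarith
  | 0, k + 1, h => by omega
  | 1, 1, _ => by norm_num [corankProb, tri]; linarith
  | 1, k + 2, h => by omega
  | n + 2, k + 1, h => by
    have hT : 0 < q ^ tri (k + 1) := by positivity
    rcases h.eq_or_lt with h | h
    · rw [h, corankProb_self]
      have : 0 < q ^ tri (n + 2) := by positivity
      linarith
    have h3 := sub_pow_nonneg hq hq3 (n + 1)
    have h0 := corankProb_nonneg hq hq3 n (k + 1)
    have h5 := half_mul_le_corankProb (show k ≤ n + 1 by omega)
    have h5' := corankProb_nonneg hq hq3 (n + 1) k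
    rw [corankProb]
    rcases (show k ≤ n by omega).eq_or_lt with h | h
    · subst h
      rw [corankProb_self]
      nlinarith [mul_nonneg h3 h0, mul_nonneg (pow_pos hq (k + 2)).le h5',
        mul_nonneg hT.le (sub_nonneg.2 hq3)]
    · have h1 := mul_le_mul_of_nonneg_left (half_mul_le_corankProb (show k + 1 ≤ n + 1 by omega))
        (by linarith : 0 ≤ 1 - q)
      have h2 := mul_le_mul_of_nonneg_left (half_mul_le_corankProb (show k + 1 ≤ n by omega)) h3
      have h6 := mul_le_mul_of_nonneg_left h5 (by positivity : 0 ≤ q ^ (n + 2))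
      have h7 : q ^ (n + 2) * q ^ tri (k + 1) ≤ q ^ (n + 2) * q ^ tri k := by
        refine mul_le_mul_of_nonneg_left (pow_le_pow_of_le_one hq.le (by linarith) ?_) (by positivity)
        rw [tri_succ]
        omega
      nlinarith

-- For q = 1/p this is the expected number of kernel vectors: 1 for the zero vector plus (q^(-n) -
-- 1) q^n for the others.
omit hq3 in
theorem sum_corankProb_mul_inv_pow : ∀ n : ℕ,
    ∑ k ∈ Finset.range (n + 1), corankProb q n k * q⁻¹ ^ k = 2 - q ^ n
  | 0 => by norm_num [corankProb]
  | 1 => by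
    norm_num [corankProb, Finset.sum_range_succ]
    field_simp
    ring
  | n + 2 => by
    rw [sum_corankProb_succ_succ, sum_corankProb_mul_inv_pow (n + 1),
      sum_corankProb_mul_inv_pow n]
    simp only [pow_succ q⁻¹, ← mul_assoc, ← Finset.sum_mul]
    rw [sum_corankProb_mul_inv_pow (n + 1)]
    field_simp
    ring

omit hq hq3 in
theorem sum_corankProb : ∀ n : ℕ, ∑ k ∈ Finset.range (n + 1), corankProb q n k = 1
  | 0 => by norm_num [corankProb]
  | 1 => by norm_num [corankProb, Finset.sum_range_succ]
  | n + 2 => by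
    have := sum_corankProb_succ_succ q n fun _ => 1
    simp only [mul_one] at this
    rw [this, sum_corankProb (n + 1), sum_corankProb n]
    ring

end

/-! ### Analysis of the recursion -/

/-- The recursion satisfied by `symProb`. -/
structure RankRec (q : ℝ) (r : ℕ) (f : ℕ → ℕ → ℝ) : Prop where
  nonneg : ∀ n s, 0 ≤ f n s
  zero : ∀ n, f n 0 = 1
  step : ∀ n s, s ≠ 0 → f n s =
    ∑ k ∈ Finset.Ico r (n + 1), corankProb q n k * f k (s - (k + 1 - r))

theorem symProb_rankRec (p : ℕ) [hp : Fact p.Prime] (r : ℕ) :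
    RankRec (p : ℝ)⁻¹ r (symProb p r) where
  nonneg := symProb_nonneg p r
  zero := symProb_zero_right p r
  step n _ hs := symProb_eq_sum p r hs n

namespace RankRec
variable {q : ℝ} (hq : 0 < q) (hq3 : q ≤ 1 / 3) {r : ℕ} {f : ℕ → ℕ → ℝ} (hf : RankRec q r f)

include hf in
theorem eq_zero_of_lt {n s : ℕ} (h : n < r) (hs : s ≠ 0) : f n s = 0 := by
  rw [hf.step n s hs, Finset.Ico_eq_empty (by omega), Finset.sum_empty]

/-! ### Rank at most `n - 1` -/

-- The limit profile is a fixed point of the recursion normalized with slope 1. Since q^(-k)(1 -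
-- q^k) = q^(-k) - 1, the sum is the difference of the moments 2 - q^n and 1; the term k = 0 is
-- zero.
omit hf in
theorem sum_corankProb_mul_limit (hq : 0 < q) (n : ℕ) :
    ∑ k ∈ Finset.Ico 1 (n + 1), corankProb q n k * (q⁻¹ ^ k * ((1 - q ^ k) / (1 - q))) =
      (1 - q ^ n) / (1 - q) := by
  have h1 : ∑ k ∈ Finset.range (n + 1), corankProb q n k * (q⁻¹ ^ k * ((1 - q ^ k) / (1 - q))) =
      (1 - q ^ n) / (1 - q) := by
    have : ∀ k, corankProb q n k * (q⁻¹ ^ k * ((1 - q ^ k) / (1 - q))) =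
        (corankProb q n k * q⁻¹ ^ k - corankProb q n k) / (1 - q) := by
      intro k
      have : q⁻¹ ^ k * q ^ k = 1 := by rw [← mul_pow, inv_mul_cancel₀ hq.ne', one_pow]
      linear_combination (- corankProb q n k / (1 - q)) * this
    simp only [this]
    rw [← Finset.sum_div, Finset.sum_sub_distrib, sum_corankProb, sum_corankProb_mul_inv_pow hq]
    ring
  rw [← h1, Finset.range_eq_Ico, Finset.sum_eq_sum_Ico_succ_bot (by omega : 0 < n + 1)]
  simp

omit hf in
include hq hq3 in
theorem one_le_limit {n : ℕ} (hn : 1 ≤ n) : 1 ≤ (1 - q ^ n) / (1 - q) := by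
  rw [le_div_iff₀ (by linarith)]
  have : q ^ n ≤ q := pow_le_of_le_one hq.le (by linarith) (by omega)
  linarith

omit hf in
include hq hq3 in
theorem limit_le (n : ℕ) : (1 - q ^ n) / (1 - q) ≤ 3 / 2 := by
  rw [div_le_iff₀ (by linarith)]
  have : 0 < q ^ n := by positivity
  linarith

omit hf in
theorem inv_pow_eq_mul (k s : ℕ) (h : k ≤ s) : q⁻¹ ^ s = q⁻¹ ^ k * q⁻¹ ^ (s - k) := by
  rw [← pow_add, Nat.add_sub_cancel' h]

omit hf in
include hq hq3 in
theorem inv_pow_le_mul (a s t : ℕ) : q⁻¹ ^ (a * s) ≤ q⁻¹ ^ (a * t) * q⁻¹ ^ (a * (s - t)) := by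
  rw [← pow_add, ← mul_add]
  refine pow_le_pow_right₀ ((one_le_inv₀ hq).2 (by linarith)) (Nat.mul_le_mul_left a (by omega))

include hq hq3 in
theorem mul_inv_pow_le_limit (hf : RankRec q 1 f) (s : ℕ) :
    ∀ n, 1 ≤ n → f n s * q⁻¹ ^ s ≤ (1 - q ^ n) / (1 - q) := by
  induction s using Nat.strong_induction_on with
  | _ s ih =>
    intro n hn
    rcases Nat.eq_zero_or_pos s with rfl | hs
    · rw [hf.zero]
      simpa using one_le_limit hq hq3 hn
    rw [hf.step n s hs.ne', Finset.sum_mul, ← sum_corankProb_mul_limit hq n]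
    refine Finset.sum_le_sum fun k hk => ?_
    have hk1 := (Finset.mem_Ico.1 hk).1
    rw [mul_assoc]
    refine mul_le_mul_of_nonneg_left ?_ (corankProb_nonneg hq hq3 n k)
    rw [Nat.add_sub_cancel]
    have h1 := inv_pow_le_mul hq hq3 1 s k
    simp only [one_mul] at h1
    have h2 := ih (s - k) (by omega) k hk1
    have h3 := mul_le_mul_of_nonneg_left h1 (hf.nonneg k (s - k))
    have h4 := mul_le_mul_of_nonneg_left h2 (by positivity : 0 ≤ q⁻¹ ^ k)
    linarith

theorem one_eq_pow (hf : RankRec q 1 f) (s : ℕ) : f 1 s = q ^ s := by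
  induction s with
  | zero => rw [hf.zero, pow_zero]
  | succ s ih =>
    rw [hf.step 1 _ (by omega)]
    simp [ih, corankProb, pow_succ, mul_comm]

-- This is the contraction factor for an error of the form (9/10)^s, the power (10/9)^k paying for
-- the time k spent.
omit hf in
include hq hq3 in
theorem sum_corankProb_mul_tail_le (n : ℕ) :
    ∑ k ∈ Finset.Ico 2 (n + 1), corankProb q n k * (q⁻¹ ^ k * (10 / 9) ^ k) ≤ 1 := by
  have hterm : ∀ k ∈ Finset.Ico 2 (n + 1), corankProb q n k * (q⁻¹ ^ k * (10 / 9) ^ k) ≤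
      54 * (10 / 81) ^ k := by
    intro k hk
    have hk2 := (Finset.mem_Ico.1 hk).1
    obtain ⟨j, rfl⟩ := Nat.exists_eq_add_of_le' hk2
    have h1 : q ^ tri (j + 2) * q⁻¹ ^ (j + 2) = q ^ tri (j + 1) := by
      rw [tri_succ (j + 1), pow_add, mul_assoc, ← mul_pow, mul_inv_cancel₀ hq.ne', one_pow, mul_one]
    have h2 : 2 * j + 1 ≤ tri (j + 1) := by
      have := two_mul_tri (j + 1)
      nlinarith [sq_nonneg ((j : ℤ) - 1), Nat.le_mul_self j]
    have h3 : q ^ tri (j + 1) ≤ (1 / 3) ^ (2 * j + 1) :=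
      (pow_le_pow_of_le_one hq.le (by linarith) h2).trans (pow_le_pow_left₀ hq.le hq3 _)
    have h4 := corankProb_le_two_mul hq hq3 n (j + 2)
    calc corankProb q n (j + 2) * (q⁻¹ ^ (j + 2) * (10 / 9) ^ (j + 2))
        ≤ 2 * q ^ tri (j + 2) * (q⁻¹ ^ (j + 2) * (10 / 9) ^ (j + 2)) :=
          mul_le_mul_of_nonneg_right h4 (by positivity)
      _ = 2 * q ^ tri (j + 1) * (10 / 9) ^ (j + 2) := by rw [← h1]; ring
      _ ≤ 2 * (1 / 3) ^ (2 * j + 1) * (10 / 9) ^ (j + 2) := by gcongr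
      _ = 54 * (10 / 81) ^ (j + 2) := by
        rw [pow_succ, pow_mul, show (10 / 81 : ℝ) = (1 / 3) ^ 2 * (10 / 9) by norm_num,
          mul_pow ((1 / 3 : ℝ) ^ 2), pow_add ((1 / 3 : ℝ) ^ 2)]
        ring
  refine (Finset.sum_le_sum hterm).trans ?_
  rw [← Finset.mul_sum]
  rcases Nat.lt_or_ge (n + 1) 2 with h | h
  · rw [Finset.Ico_eq_empty (by omega)]
    simp
  · rw [geom_sum_Ico (by norm_num) h]
    have : (0 : ℝ) < (10 / 81) ^ (n + 1) := by positivity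
    rw [mul_div_assoc', div_le_one_of_neg (by norm_num)]
    nlinarith

-- The term k = 1 carries no error, because f(1, s) = q^s exactly; the error therefore comes only
-- from k ≥ 2, where the tail sum is at most 1. When k > s the claimed lower bound for that term is
-- nonpositive.
include hq hq3 in
theorem limit_le_mul_inv_pow (hf : RankRec q 1 f) (s : ℕ) :
    ∀ n, 1 ≤ n → (1 - q ^ n) / (1 - q) - 3 / 2 * (9 / 10) ^ s ≤ f n s * q⁻¹ ^ s := by
  induction s using Nat.strong_induction_on with
  | _ s ih =>
    intro n hn
    rcases Nat.eq_zero_or_pos s with rfl | hs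
    · rw [hf.zero]
      have := limit_le hq hq3 n
      norm_num
      linarith
    rw [hf.step n s hs.ne', Finset.sum_mul, ← sum_corankProb_mul_limit hq n,
      Finset.sum_eq_sum_Ico_succ_bot (show 1 < n + 1 by omega),
      Finset.sum_eq_sum_Ico_succ_bot (show 1 < n + 1 by omega)]
    have h1 : corankProb q n 1 * f 1 (s - (1 + 1 - 1)) * q⁻¹ ^ s =
        corankProb q n 1 * (q⁻¹ ^ 1 * ((1 - q ^ 1) / (1 - q))) := by
      rw [hf.one_eq_pow, inv_pow_eq_mul 1 s hs, pow_one q, div_self (by linarith : 1 - q ≠ 0)]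
      have : q ^ (s - 1) * q⁻¹ ^ (s - 1) = 1 := by
        rw [← mul_pow, mul_inv_cancel₀ hq.ne', one_pow]
      rw [show 1 + 1 - 1 = 1 from rfl]
      linear_combination (corankProb q n 1 * q⁻¹ ^ 1) * this
    have h2 : ∑ k ∈ Finset.Ico (1 + 1) (n + 1),
          corankProb q n k * (q⁻¹ ^ k * ((1 - q ^ k) / (1 - q))) -
        3 / 2 * (9 / 10) ^ s * ∑ k ∈ Finset.Ico 2 (n + 1), corankProb q n k * (q⁻¹ ^ k * (10 / 9) ^ k) ≤
        ∑ k ∈ Finset.Ico (1 + 1) (n + 1), corankProb q n k * f k (s - (k + 1 - 1)) * q⁻¹ ^ s := by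
      rw [Finset.mul_sum, ← Finset.sum_sub_distrib]
      refine Finset.sum_le_sum fun k hk => ?_
      have hk1 := (Finset.mem_Ico.1 hk).1
      have key : q⁻¹ ^ k * ((1 - q ^ k) / (1 - q)) -
          3 / 2 * (9 / 10) ^ s * (q⁻¹ ^ k * (10 / 9) ^ k) ≤ f k (s - k) * q⁻¹ ^ s := by
        have hqk : 0 < q⁻¹ ^ k := by positivity
        rcases le_or_gt k s with h | h
        · have h3 := ih (s - k) (by omega) k (by omega)
          rw [inv_pow_eq_mul k s h]
          have h4 : (9 / 10 : ℝ) ^ s * (10 / 9) ^ k = (9 / 10) ^ (s - k) := by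
            rw [← pow_sub_mul_pow (9 / 10 : ℝ) h, mul_assoc, ← mul_pow]
            norm_num
          have h5 := mul_le_mul_of_nonneg_left h3 hqk.le
          rw [← h4] at h5
          linarith
        · have h3 := mul_nonneg (hf.nonneg k (s - k)) (by positivity : 0 ≤ q⁻¹ ^ s)
          have h4 : (1 : ℝ) ≤ (9 / 10 : ℝ) ^ s * (10 / 9) ^ k := by
            rw [← pow_sub_mul_pow (10 / 9 : ℝ) h.le, mul_left_comm, ← mul_pow]
            norm_num
            exact one_le_pow₀ (by norm_num)
          have h5 := limit_le hq hq3 k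
          have h6 := mul_le_mul_of_nonneg_left h4 hqk.le
          have h7 := mul_le_mul_of_nonneg_left h5 hqk.le
          linarith
      have := mul_le_mul_of_nonneg_left key (corankProb_nonneg hq hq3 n k)
      rw [Nat.add_sub_cancel]
      linarith
    have h3 := sum_corankProb_mul_tail_le hq hq3 n
    have h4 := mul_le_mul_of_nonneg_left h3 (by positivity : (0 : ℝ) ≤ 3 / 2 * (9 / 10) ^ s)
    rw [h1]
    linarith

/-! ### Normalized recursion -/

-- The term k = n has coefficient exactly 1, since `corankProb q n n` = q^(tri n); the crude factor
-- 2 is paid only for k < n. A doubled self-loop at 2r - 2 or 2r - 1 would make the bound grow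
-- exponentially.
include hq hq3 hf in
theorem mul_inv_pow_le (σ : ℕ) {n s : ℕ} (hs : s ≠ 0) (hn : r ≤ n) {w : ℕ → ℝ}
    (hw : ∀ k, r ≤ k → k ≤ n → q ^ tri k * q⁻¹ ^ (σ * (k + 1 - r)) ≤ w k) :
    f n s * q⁻¹ ^ (σ * s) ≤
      w n * (f n (s - (n + 1 - r)) * q⁻¹ ^ (σ * (s - (n + 1 - r)))) +
      2 * ∑ k ∈ Finset.Ico r n, w k * (f k (s - (k + 1 - r)) * q⁻¹ ^ (σ * (s - (k + 1 - r)))) := by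
  have hq' : 0 < q⁻¹ := by positivity
  have main : ∀ k : ℕ, r ≤ k → k ≤ n → ∀ a : ℝ, 0 ≤ a → corankProb q n k ≤ a * q ^ tri k →
      corankProb q n k * f k (s - (k + 1 - r)) * q⁻¹ ^ (σ * s) ≤
        a * (w k * (f k (s - (k + 1 - r)) * q⁻¹ ^ (σ * (s - (k + 1 - r))))) := by
    intro k hk hk' a ha hc
    have h0 := hf.nonneg k (s - (k + 1 - r))
    calc corankProb q n k * f k (s - (k + 1 - r)) * q⁻¹ ^ (σ * s)
        ≤ a * q ^ tri k * f k (s - (k + 1 - r)) *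
          (q⁻¹ ^ (σ * (k + 1 - r)) * q⁻¹ ^ (σ * (s - (k + 1 - r)))) := by
          have h1 := inv_pow_le_mul hq hq3 σ s (k + 1 - r)
          gcongr
      _ = a * ((q ^ tri k * q⁻¹ ^ (σ * (k + 1 - r))) *
          (f k (s - (k + 1 - r)) * q⁻¹ ^ (σ * (s - (k + 1 - r))))) := by ring
      _ ≤ _ := by
          have := hw k hk hk'
          gcongr
  rw [hf.step n s hs, Finset.sum_mul, Finset.sum_Ico_succ_top hn, add_comm]
  refine add_le_add ?_ ?_
  · have := main n hn le_rfl 1 zero_le_one (by rw [corankProb_self, one_mul])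
    rwa [one_mul] at this
  · rw [Finset.mul_sum]
    refine Finset.sum_le_sum fun k hk => ?_
    have := Finset.mem_Ico.1 hk
    exact main k this.1 this.2.le 2 zero_le_two (corankProb_le_two_mul hq hq3 n k)

include hq hq3 in
omit hf in
theorem weight_le {a b e : ℕ} (h : b + e ≤ a) : q ^ a * q⁻¹ ^ b ≤ (1 / 3) ^ e := by
  obtain ⟨d, rfl⟩ := Nat.exists_eq_add_of_le h
  have h1 : q ^ b * q⁻¹ ^ b = 1 := by rw [← mul_pow, mul_inv_cancel₀ hq.ne', one_pow]
  have h2 : q ^ (b + e + d) * q⁻¹ ^ b = q ^ (e + d) := by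
    rw [add_assoc, pow_add]
    linear_combination q ^ (e + d) * h1
  rw [h2]
  exact (pow_le_pow_of_le_one hq.le (by linarith) (by omega)).trans (pow_le_pow_left₀ hq.le hq3 _)

/-! ### The range `n + 2 ≤ 2 r` -/

omit hf in
theorem sum_Ico_pow_three_le (r n : ℕ) : ∑ k ∈ Finset.Ico r n, (3 : ℝ) ^ k ≤ 3 ^ n / 2 := by
  induction n with
  | zero => simp
  | succ n ih =>
    rcases le_or_gt r n with h | h
    · rw [Finset.sum_Ico_succ_top h, pow_succ]
      linarith
    · rw [Finset.Ico_eq_empty (by omega), Finset.sum_empty]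
      positivity

-- With slope N the weight at k is at most 3^(k-N-1), so the weights, with the factor 2 below n, sum
-- to at most 2/3.
include hq hq3 hf in
theorem mul_inv_pow_le_one {N : ℕ} (hN : N + 2 ≤ 2 * r) (s : ℕ) :
    ∀ n, n ≤ N → f n s * q⁻¹ ^ (N * s) ≤ 1 := by
  induction s using Nat.strong_induction_on with
  | _ s ih =>
    intro n hn
    rcases Nat.eq_zero_or_pos s with rfl | hs
    · simp [hf.zero]
    rcases lt_or_ge n r with hr | hr
    · simp [hf.eq_zero_of_lt hr hs.ne']
    have hw : ∀ k, r ≤ k → k ≤ n → q ^ tri k * q⁻¹ ^ (N * (k + 1 - r)) ≤ 3 ^ k / 3 ^ (N + 1) := by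
      intro k hk hkn
      have h1 : N * (k + 1 - r) + (1 + N - k) ≤ tri k := by
        have h2 := two_mul_tri k
        obtain ⟨j, rfl⟩ := Nat.exists_eq_add_of_le (hkn.trans hn)
        obtain ⟨t, rfl⟩ := Nat.exists_eq_add_of_le hk
        rw [show r + t + 1 - r = t + 1 by omega, show 1 + (r + t + j) - (r + t) = j + 1 by omega]
        obtain ⟨d, hd⟩ := Nat.exists_eq_add_of_le hN
        have hr' : r = t + j + 2 + d := by omega
        subst hr'
        nlinarith [Nat.le_mul_self j, Nat.zero_le (d * t), Nat.zero_le (d * j), Nat.zero_le (d * d)]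
      refine (weight_le hq hq3 h1).trans (le_of_eq ?_)
      rw [one_div, inv_pow, inv_eq_one_div, div_eq_div_iff (by positivity) (by positivity),
        one_mul, ← pow_add]
      congr 1
      omega
    refine (hf.mul_inv_pow_le hq hq3 N hs.ne' hr hw).trans ?_
    have h1 : ∀ k, r ≤ k → k ≤ n →
        (3 : ℝ) ^ k / 3 ^ (N + 1) * (f k (s - (k + 1 - r)) * q⁻¹ ^ (N * (s - (k + 1 - r)))) ≤
          3 ^ k / 3 ^ (N + 1) := fun k hk hk' =>
      mul_le_of_le_one_right (by positivity) (ih _ (by omega) k (hk'.trans hn))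
    have h2 := Finset.sum_le_sum fun k (hk : k ∈ Finset.Ico r n) =>
      h1 k (Finset.mem_Ico.1 hk).1 (Finset.mem_Ico.1 hk).2.le
    rw [← Finset.sum_div] at h2
    have h3 : (∑ k ∈ Finset.Ico r n, (3 : ℝ) ^ k) / 3 ^ (N + 1) ≤ 3 ^ n / 2 / 3 ^ (N + 1) := by
      gcongr
      exact sum_Ico_pow_three_le r n
    have h4 : (3 : ℝ) ^ n / 3 ^ (N + 1) ≤ 1 / 3 := by
      rw [div_le_iff₀ (by positivity), pow_succ]
      have : (3 : ℝ) ^ n ≤ 3 ^ N := pow_le_pow_right₀ (by norm_num) hn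
      linarith
    have h5 := h1 n hr le_rfl
    rw [div_right_comm] at h3
    linarith

end RankRec

/-! ### The weights for slope 2r - 1 -/

theorem two_mul_sub_one_le_tri (i : ℕ) : 2 * i - 1 ≤ tri i := by
  have := two_mul_tri i
  rcases i with _ | _ | i
  · simp
  · simp at this ⊢
    omega
  · have : 2 * (i + 2) - 1 = 2 * i + 3 := by omega
    rw [this]
    nlinarith [Nat.le_mul_self i]

theorem one_third_pow_tri_le {i : ℕ} (hi : 1 ≤ i) : (1 / 3 : ℝ) ^ tri i ≤ 3 / 9 ^ i := by
  refine (pow_le_pow_of_le_one (by norm_num) (by norm_num) (two_mul_sub_one_le_tri i)).trans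
    (le_of_eq ?_)
  obtain ⟨j, rfl⟩ := Nat.exists_eq_add_of_le' hi
  rw [show 2 * (j + 1) - 1 = 2 * j + 1 by omega, pow_succ, pow_mul, pow_succ (9 : ℝ),
    show (1 / 3 : ℝ) ^ 2 = 9⁻¹ by norm_num, inv_pow]
  field_simp
  norm_num

/-- `tri` at distance `i` below `2 r - 2`. -/
theorem tri_below {r k i : ℕ} (hk : r ≤ k) (h : k + i + 2 = 2 * r) :
    tri k = (2 * r - 1) * (k + 1 - r) + tri i := by
  have h1 := two_mul_tri k
  have h2 := two_mul_tri i
  obtain ⟨t, rfl⟩ := Nat.exists_eq_add_of_le hk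
  have hr : r = t + i + 2 := by omega
  subst hr
  rw [show 2 * (t + i + 2) - 1 = 2 * t + 2 * i + 3 by omega,
    show t + i + 2 + t + 1 - (t + i + 2) = t + 1 by omega]
  nlinarith

/-- `tri` at distance `j` above `2 r - 1`. -/
theorem tri_above {r k j : ℕ} (hr : 1 ≤ r) (h : k + 1 = 2 * r + j) :
    tri k = (2 * r - 1) * (k + 1 - r) + tri j := by
  have h1 := two_mul_tri k
  have h2 := two_mul_tri j
  obtain ⟨t, rfl⟩ := Nat.exists_eq_add_of_le' hr
  have hk : k = 2 * t + 1 + j := by omega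
  subst hk
  rw [show 2 * (t + 1) - 1 = 2 * t + 1 by omega,
    show 2 * t + 1 + j + 1 - (t + 1) = t + 1 + j by omega]
  nlinarith

theorem sum_Ico_pow_nine_le (r n : ℕ) : ∑ k ∈ Finset.Ico r n, (9 : ℝ) ^ k ≤ 9 ^ n / 8 := by
  induction n with
  | zero => simp
  | succ n ih =>
    rcases le_or_gt r n with h | h
    · rw [Finset.sum_Ico_succ_top h, pow_succ]
      linarith
    · rw [Finset.Ico_eq_empty (by omega), Finset.sum_empty]
      positivity

theorem sum_Ico_inv_pow_nine_le (a n : ℕ) :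
    ∑ k ∈ Finset.Ico (a + 1) n, 3 * (9 : ℝ) ^ a / 9 ^ k ≤ 3 / 8 := by
  rcases le_or_gt (a + 1) n with h | h
  · have : ∑ k ∈ Finset.Ico (a + 1) n, 3 * (9 : ℝ) ^ a / 9 ^ k = 3 / 8 - 27 / 8 * 9 ^ a / 9 ^ n := by
      induction n, h using Nat.le_induction with
      | base =>
        rw [Finset.Ico_self, Finset.sum_empty, pow_succ]
        field_simp
        norm_num
      | succ n hn ih =>
        rw [Finset.sum_Ico_succ_top hn, ih, pow_succ]
        field_simp
        ring
    rw [this]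
    have : 0 < 27 / 8 * (9 : ℝ) ^ a / 9 ^ n := by positivity
    linarith
  · rw [Finset.Ico_eq_empty (by omega)]
    norm_num

/-- The rate θ is tuned to r: every step to k ≤ 2r - 2 takes time at most r - 1, and so costs at
most a factor 2, uniformly in r. -/
theorem pow_sub_le_two_mul {θ : ℝ} {r : ℕ} (h0 : 0 < θ) (h1 : θ ≤ 1) (h2 : θ ^ (r - 1) = 1 / 2)
    {s t : ℕ} (ht : t ≤ r - 1) : θ ^ (s - t) ≤ 2 * θ ^ s := by
  have h3 : 1 / 2 ≤ θ ^ t := h2 ▸ pow_le_pow_of_le_one h0.le h1 ht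
  rcases le_total t s with h | h
  · rw [← pow_sub_mul_pow θ h]
    nlinarith [pow_pos h0 (s - t)]
  · rw [Nat.sub_eq_zero_of_le h, pow_zero]
    have := pow_le_pow_of_le_one h0.le h1 h
    linarith

theorem exists_pow_eq_half {r : ℕ} (hr : 2 ≤ r) :
    ∃ θ : ℝ, 0 < θ ∧ θ ≤ 1 ∧ θ ^ (r - 1) = 1 / 2 :=
  ⟨(1 / 2 : ℝ) ^ (((r - 1 : ℕ) : ℝ)⁻¹), by positivity,
    Real.rpow_le_one (by norm_num) (by norm_num) (by positivity),
    Real.rpow_inv_natCast_pow (by norm_num) (by omega)⟩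

namespace RankRec
variable {q : ℝ} (hq : 0 < q) (hq3 : q ≤ 1 / 3) {r : ℕ} {f : ℕ → ℕ → ℝ} (hf : RankRec q r f)
  (hr : 2 ≤ r) {θ : ℝ} (hθ : 0 < θ) (hθ1 : θ ≤ 1) (hθr : θ ^ (r - 1) = 1 / 2)

/-! ### Upper bounds with slope `2 r - 1` -/

omit hf in
include hq hq3 in
theorem weight_below {k : ℕ} (hk : r ≤ k) (h : k + 3 ≤ 2 * r) :
    q ^ tri k * q⁻¹ ^ ((2 * r - 1) * (k + 1 - r)) ≤ 3 * 9 ^ k / 9 ^ (2 * r - 2) := by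
  obtain ⟨i, hi⟩ := Nat.exists_eq_add_of_le (show k + 2 ≤ 2 * r by omega)
  refine (weight_le hq hq3 (tri_below hk (by omega)).ge).trans
    ((one_third_pow_tri_le (i := i) (by omega)).trans (le_of_eq ?_))
  rw [show 2 * r - 2 = i + k by omega, pow_add]
  field_simp

omit hf in
include hq hq3 in
theorem weight_le_one {k : ℕ} (hk : 2 * r ≤ k + 2) (hrk : r ≤ k) (hr1 : 1 ≤ r) :
    q ^ tri k * q⁻¹ ^ ((2 * r - 1) * (k + 1 - r)) ≤ 1 := by
  have h : (2 * r - 1) * (k + 1 - r) ≤ tri k := by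
    rcases hk.eq_or_lt with h | h
    · exact (Nat.le_add_right _ _).trans (tri_below (i := 0) hrk (by omega)).ge
    · obtain ⟨j, hj⟩ := Nat.exists_eq_add_of_le (show 2 * r ≤ k + 1 by omega)
      exact (Nat.le_add_right _ _).trans (tri_above (j := j) hr1 hj).ge
  simpa using weight_le (e := 0) hq hq3 h

omit hf in
include hq hq3 in
theorem weight_above {k : ℕ} (hr1 : 1 ≤ r) (h : 2 * r ≤ k) :
    q ^ tri k * q⁻¹ ^ ((2 * r - 1) * (k + 1 - r)) ≤ 3 * 9 ^ (2 * r - 1) / 9 ^ k := by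
  obtain ⟨j, hj⟩ := Nat.exists_eq_add_of_le (show 2 * r ≤ k + 1 by omega)
  refine (weight_le hq hq3 (tri_above hr1 hj).ge).trans
    ((one_third_pow_tri_le (i := j) (by omega)).trans (le_of_eq ?_))
  rw [show k = 2 * r - 1 + j by omega, pow_add]
  field_simp

include hq hq3 hf hθ hθ1 hθr

/-- Strictly below 2r - 2 all weights are small enough to absorb the factor 2 from the time shift,
which leaves geometric decay. -/
theorem mul_inv_pow_le_pow (s : ℕ) :
    ∀ n, n + 3 ≤ 2 * r → f n s * q⁻¹ ^ ((2 * r - 1) * s) ≤ θ ^ s := by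
  induction s using Nat.strong_induction_on with
  | _ s ih =>
    intro n hn
    rcases Nat.eq_zero_or_pos s with rfl | hs
    · simp [hf.zero]
    rcases lt_or_ge n r with hr | hr
    · simp only [hf.eq_zero_of_lt hr hs.ne', zero_mul]
      positivity
    refine (hf.mul_inv_pow_le hq hq3 (2 * r - 1) hs.ne' hr
      (w := fun k => 3 * 9 ^ k / 9 ^ (2 * r - 2))
      fun k hk hk' => weight_below hq hq3 hk (by omega)).trans ?_
    have h1 : ∀ k, r ≤ k → k ≤ n → 3 * 9 ^ k / 9 ^ (2 * r - 2) *
        (f k (s - (k + 1 - r)) * q⁻¹ ^ ((2 * r - 1) * (s - (k + 1 - r)))) ≤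
          3 * 9 ^ k / 9 ^ (2 * r - 2) * (2 * θ ^ s) := fun k hk hk' =>
      mul_le_mul_of_nonneg_left ((ih _ (by omega) k (by omega)).trans
        (pow_sub_le_two_mul hθ hθ1 hθr (by omega))) (by positivity)
    have h2 := Finset.sum_le_sum fun k (hk : k ∈ Finset.Ico r n) =>
      h1 k (Finset.mem_Ico.1 hk).1 (Finset.mem_Ico.1 hk).2.le
    rw [← Finset.sum_mul, ← Finset.sum_div, ← Finset.mul_sum] at h2
    have h5 := h1 n hr le_rfl
    have h3 := sum_Ico_pow_nine_le r n
    have h4 : (9 : ℝ) ^ n / 9 ^ (2 * r - 2) ≤ 1 / 9 := by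
      rw [div_le_iff₀ (by positivity), show 2 * r - 2 = (2 * r - 3) + 1 by omega, pow_succ]
      have : (9 : ℝ) ^ n ≤ 9 ^ (2 * r - 3) := pow_le_pow_right₀ (by norm_num) (by omega)
      linarith
    have h6 : 3 * (∑ k ∈ Finset.Ico r n, (9 : ℝ) ^ k) / 9 ^ (2 * r - 2) ≤
        3 / 8 * (9 ^ n / 9 ^ (2 * r - 2)) := by
      rw [mul_div_assoc', div_le_div_iff_of_pos_right (by positivity)]
      linarith
    have h7 : 0 < θ ^ s := by positivity
    have h8 := mul_le_mul_of_nonneg_right h6 (by positivity : 0 ≤ 2 * θ ^ s)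
    have h9 := mul_le_mul_of_nonneg_right h4 h7.le
    have e1 : 3 * (9 : ℝ) ^ n / 9 ^ (2 * r - 2) * (2 * θ ^ s) =
        6 * (9 ^ n / 9 ^ (2 * r - 2) * θ ^ s) := by ring
    have e2 : 3 / 8 * ((9 : ℝ) ^ n / 9 ^ (2 * r - 2)) * (2 * θ ^ s) =
        3 / 4 * (9 ^ n / 9 ^ (2 * r - 2) * θ ^ s) := by ring
    rw [e1] at h5
    rw [e2] at h8
    refine (add_le_add h5 (mul_le_mul_of_nonneg_left (h2.trans h8) zero_le_two)).trans ?_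
    linarith

include hr

theorem sum_below_le {s : ℕ} : ∑ k ∈ Finset.Ico r (2 * r - 2), 3 * 9 ^ k / 9 ^ (2 * r - 2) *
    (f k (s - (k + 1 - r)) * q⁻¹ ^ ((2 * r - 1) * (s - (k + 1 - r)))) ≤ 3 / 4 * θ ^ s := by
  have h1 : ∀ k ∈ Finset.Ico r (2 * r - 2), 3 * 9 ^ k / 9 ^ (2 * r - 2) *
      (f k (s - (k + 1 - r)) * q⁻¹ ^ ((2 * r - 1) * (s - (k + 1 - r)))) ≤
        3 * 9 ^ k / 9 ^ (2 * r - 2) * (2 * θ ^ s) := fun k hk => by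
    have hk := Finset.mem_Ico.1 hk
    exact mul_le_mul_of_nonneg_left ((hf.mul_inv_pow_le_pow hq hq3 hθ hθ1 hθr _ k (by omega)).trans
      (pow_sub_le_two_mul hθ hθ1 hθr (by omega))) (by positivity)
  refine (Finset.sum_le_sum h1).trans ?_
  rw [← Finset.sum_mul, ← Finset.sum_div, ← Finset.mul_sum]
  have h3 : 3 * (∑ k ∈ Finset.Ico r (2 * r - 2), (9 : ℝ) ^ k) / 9 ^ (2 * r - 2) ≤ 3 / 8 := by
    rw [div_le_iff₀ (by positivity)]
    linarith [sum_Ico_pow_nine_le r (2 * r - 2)]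
  nlinarith [pow_pos hθ s]

/-- One turn of the self-loop doubles θ^s, giving 5 - 4θ^s, while the inflow from below is at most
(3/2)θ^s; the subtracted term makes the total inflow summable. -/
theorem mul_inv_pow_le_five_sub (s : ℕ) :
    f (2 * r - 2) s * q⁻¹ ^ ((2 * r - 1) * s) ≤ 5 - 2 * θ ^ s := by
  induction s using Nat.strong_induction_on with
  | _ s ih =>
    rcases Nat.eq_zero_or_pos s with rfl | hs
    · norm_num [hf.zero]
    refine (hf.mul_inv_pow_le hq hq3 (2 * r - 1) hs.ne' (show r ≤ 2 * r - 2 by omega)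
      (w := fun k => if k = 2 * r - 2 then 1 else 3 * 9 ^ k / 9 ^ (2 * r - 2))
      fun k hk hk' => ?_).trans ?_
    · split_ifs with h
      · exact weight_le_one hq hq3 (by omega) hk (by omega)
      · exact weight_below hq hq3 hk (by omega)
    rw [if_pos rfl, one_mul, show 2 * r - 2 + 1 - r = r - 1 by omega]
    have h1 : ∀ k ∈ Finset.Ico r (2 * r - 2),
        (if k = 2 * r - 2 then 1 else 3 * 9 ^ k / 9 ^ (2 * r - 2)) *
        (f k (s - (k + 1 - r)) * q⁻¹ ^ ((2 * r - 1) * (s - (k + 1 - r)))) =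
        3 * 9 ^ k / 9 ^ (2 * r - 2) *
        (f k (s - (k + 1 - r)) * q⁻¹ ^ ((2 * r - 1) * (s - (k + 1 - r)))) := fun k hk => by
      rw [if_neg (by have := Finset.mem_Ico.1 hk; omega)]
    rw [Finset.sum_congr rfl h1]
    have h2 := hf.sum_below_le hq hq3 hr hθ hθ1 hθr (s := s)
    have h4 : 0 < θ ^ s := by positivity
    have h5 : θ ^ s ≤ 1 := pow_le_one₀ hθ.le hθ1
    rcases le_or_gt (r - 1) s with h | h
    · have h3 := ih (s - (r - 1)) (by omega)
      have h6 := pow_sub_mul_pow θ h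
      rw [hθr] at h6
      linarith
    · rw [Nat.sub_eq_zero_of_le h.le, hf.zero, mul_zero, pow_zero, one_mul]
      linarith

/-- Each turn of the self-loop adds at most 2(3/4 + 5) < 12, and takes time at least 1. -/
theorem mul_inv_pow_le_linear (s : ℕ) :
    f (2 * r - 1) s * q⁻¹ ^ ((2 * r - 1) * s) ≤ 1 + 12 * s := by
  induction s using Nat.strong_induction_on with
  | _ s ih =>
    rcases Nat.eq_zero_or_pos s with rfl | hs
    · norm_num [hf.zero]
    refine (hf.mul_inv_pow_le hq hq3 (2 * r - 1) hs.ne' (show r ≤ 2 * r - 1 by omega)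
      (w := fun k => if k + 3 ≤ 2 * r then 3 * 9 ^ k / 9 ^ (2 * r - 2) else 1)
      fun k hk hk' => ?_).trans ?_
    · split_ifs with h
      · exact weight_below hq hq3 hk (by omega)
      · exact weight_le_one hq hq3 (by omega) hk (by omega)
    rw [if_neg (by omega), one_mul, show 2 * r - 1 + 1 - r = r by omega,
      show Finset.Ico r (2 * r - 1) = Finset.Ico r (2 * r - 2 + 1) by congr 1; omega,
      Finset.sum_Ico_succ_top (by omega), if_neg (by omega), one_mul]
    have h1 : ∀ k ∈ Finset.Ico r (2 * r - 2),
        (if k + 3 ≤ 2 * r then 3 * 9 ^ k / 9 ^ (2 * r - 2) else 1) *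
        (f k (s - (k + 1 - r)) * q⁻¹ ^ ((2 * r - 1) * (s - (k + 1 - r)))) =
        3 * 9 ^ k / 9 ^ (2 * r - 2) *
        (f k (s - (k + 1 - r)) * q⁻¹ ^ ((2 * r - 1) * (s - (k + 1 - r)))) := fun k hk => by
      rw [if_pos (by have := Finset.mem_Ico.1 hk; omega)]
    rw [Finset.sum_congr rfl h1]
    have h2 := hf.sum_below_le hq hq3 hr hθ hθ1 hθr (s := s)
    have h3 := ih (s - r) (by omega)
    have h4 := hf.mul_inv_pow_le_five_sub hq hq3 hr hθ hθ1 hθr (s - (2 * r - 2 + 1 - r))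
    have h5 : θ ^ s ≤ 1 := pow_le_one₀ hθ.le hθ1
    have h6 : 0 < θ ^ (s - (2 * r - 2 + 1 - r)) := by positivity
    have h7 : ((s - r : ℕ) : ℝ) ≤ s - 1 := by
      have : s - r + 1 ≤ s := by omega
      have : ((s - r + 1 : ℕ) : ℝ) ≤ s := by exact_mod_cast this
      push_cast at this
      linarith
    linarith

/-- States k ≥ 2r have weights summing to at most 3/8, hence 3/4 after doubling. The remaining
quarter of 100(1 + s) covers the inflow from below and from the two resonant states. -/
theorem mul_inv_pow_le_of_le (s : ℕ) :
    ∀ n, 2 * r ≤ n + 1 → f n s * q⁻¹ ^ ((2 * r - 1) * s) ≤ 100 * (1 + s) := by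
  induction s using Nat.strong_induction_on with
  | _ s ih =>
    intro n hn
    rcases Nat.eq_zero_or_pos s with rfl | hs
    · norm_num [hf.zero]
    have hs0 : (0 : ℝ) ≤ s := Nat.cast_nonneg s
    rcases hn.eq_or_lt with hn | hn
    · have := hf.mul_inv_pow_le_linear hq hq3 hr hθ hθ1 hθr s
      rw [show n = 2 * r - 1 by omega]
      linarith
    refine (hf.mul_inv_pow_le hq hq3 (2 * r - 1) hs.ne' (show r ≤ n by omega)
      (w := fun k => if k + 3 ≤ 2 * r then 3 * 9 ^ k / 9 ^ (2 * r - 2) else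
        if 2 * r ≤ k then 3 * 9 ^ (2 * r - 1) / 9 ^ k else 1)
      fun k hk hk' => ?_).trans ?_
    · split_ifs with h h'
      · exact weight_below hq hq3 hk (by omega)
      · exact weight_above hq hq3 (by omega) h'
      · exact weight_le_one hq hq3 (by omega) hk (by omega)
    have hbig : ∀ k, 2 * r ≤ k → k ≤ n → 3 * 9 ^ (2 * r - 1) / 9 ^ k *
        (f k (s - (k + 1 - r)) * q⁻¹ ^ ((2 * r - 1) * (s - (k + 1 - r)))) ≤
        3 * 9 ^ (2 * r - 1) / 9 ^ k * (100 * (1 + s)) := fun k hk hk' => by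
      refine mul_le_mul_of_nonneg_left ((ih _ (by omega) k (by omega)).trans ?_) (by positivity)
      have : ((s - (k + 1 - r) : ℕ) : ℝ) ≤ s := by exact_mod_cast Nat.sub_le _ _
      linarith
    rw [if_neg (by omega), if_pos (by omega),
      ← Finset.sum_Ico_consecutive _ (show r ≤ 2 * r - 2 by omega) (show 2 * r - 2 ≤ n by omega),
      Finset.sum_eq_sum_Ico_succ_bot (show 2 * r - 2 < n by omega),
      Finset.sum_eq_sum_Ico_succ_bot (show 2 * r - 2 + 1 < n by omega),
      if_neg (by omega), if_neg (by omega), if_neg (by omega), if_neg (by omega), one_mul, one_mul,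
      show 2 * r - 2 + 1 = 2 * r - 1 by omega]
    have e1 : ∀ k ∈ Finset.Ico r (2 * r - 2),
        (if k + 3 ≤ 2 * r then 3 * 9 ^ k / 9 ^ (2 * r - 2) else
          if 2 * r ≤ k then 3 * 9 ^ (2 * r - 1) / 9 ^ k else 1) *
        (f k (s - (k + 1 - r)) * q⁻¹ ^ ((2 * r - 1) * (s - (k + 1 - r)))) =
        3 * 9 ^ k / 9 ^ (2 * r - 2) *
        (f k (s - (k + 1 - r)) * q⁻¹ ^ ((2 * r - 1) * (s - (k + 1 - r)))) := fun k hk => by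
      rw [if_pos (by have := Finset.mem_Ico.1 hk; omega)]
    have e2 : ∀ k ∈ Finset.Ico (2 * r - 1 + 1) n,
        (if k + 3 ≤ 2 * r then 3 * 9 ^ k / 9 ^ (2 * r - 2) else
          if 2 * r ≤ k then 3 * 9 ^ (2 * r - 1) / 9 ^ k else 1) *
        (f k (s - (k + 1 - r)) * q⁻¹ ^ ((2 * r - 1) * (s - (k + 1 - r)))) ≤
        3 * 9 ^ (2 * r - 1) / 9 ^ k * (100 * (1 + s)) := fun k hk => by
      have hk := Finset.mem_Ico.1 hk
      rw [if_neg (by omega), if_pos (by omega)]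
      exact hbig k (by omega) hk.2.le
    rw [Finset.sum_congr rfl e1]
    have h1 := hbig n (by omega) le_rfl
    have h2 := Finset.sum_le_sum e2
    rw [← Finset.sum_mul] at h2
    have h3 := sum_Ico_inv_pow_nine_le (2 * r - 1) (n + 1)
    rw [Finset.sum_Ico_succ_top (by omega)] at h3
    have h4 := hf.sum_below_le hq hq3 hr hθ hθ1 hθr (s := s)
    have h5 := hf.mul_inv_pow_le_linear hq hq3 hr hθ hθ1 hθr (s - (2 * r - 1 + 1 - r))
    have h6 := hf.mul_inv_pow_le_five_sub hq hq3 hr hθ hθ1 hθr (s - (2 * r - 1 - r))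
    have h7 : 0 < θ ^ (s - (2 * r - 1 - r)) := by positivity
    have h8 : θ ^ s ≤ 1 := pow_le_one₀ hθ.le hθ1
    have h9 : ((s - (2 * r - 1 + 1 - r) : ℕ) : ℝ) ≤ s := by exact_mod_cast Nat.sub_le _ _
    have h10 : (0 : ℝ) ≤ 3 * 9 ^ (2 * r - 1) / 9 ^ n := by positivity
    have h11 := mul_le_mul_of_nonneg_right h3 (by positivity : (0 : ℝ) ≤ 100 * (1 + s))
    have h12 := mul_nonneg h10 (by positivity : (0 : ℝ) ≤ 100 * (1 + s))
    rw [add_mul] at h11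
    linarith

end RankRec

namespace RankRec
variable {q : ℝ} (hq : 0 < q) (hq3 : q ≤ 1 / 3) {r : ℕ} {f : ℕ → ℕ → ℝ} (hf : RankRec q r f)
  (hr : 2 ≤ r)

/-! ### Lower bounds with slope `2 r - 1` -/

omit hf in
include hq in
theorem pow_mul_inv_pow_split {a σ s t : ℕ} (ha : a = σ * t) (h : t ≤ s) (x : ℝ) :
    q ^ a * x * q⁻¹ ^ (σ * s) = x * q⁻¹ ^ (σ * (s - t)) := by
  obtain ⟨d, rfl⟩ := Nat.exists_eq_add_of_le h
  rw [Nat.add_sub_cancel_left, ha, mul_add, pow_add]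
  have : q ^ (σ * t) * q⁻¹ ^ (σ * t) = 1 := by
    rw [← mul_pow, mul_inv_cancel₀ hq.ne', one_pow]
  linear_combination x * q⁻¹ ^ (σ * d) * this

include hq hq3 hf

theorem corankProb_mul_le {n k s : ℕ} (hs : s ≠ 0) (hk : r ≤ k) (hkn : k ≤ n) :
    corankProb q n k * f k (s - (k + 1 - r)) ≤ f n s := by
  rw [hf.step n s hs]
  exact Finset.single_le_sum (f := fun k => corankProb q n k * f k (s - (k + 1 - r)))
    (fun i _ => mul_nonneg (corankProb_nonneg hq hq3 n i) (hf.nonneg _ _))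
    (Finset.mem_Ico.2 ⟨hk, by omega⟩)

include hr

/-- Only the self-loop is kept; its normalized weight is exactly 1. -/
theorem one_le_mul_inv_pow (b : ℕ) :
    1 ≤ f (2 * r - 2) (b * (r - 1)) * q⁻¹ ^ ((2 * r - 1) * (b * (r - 1))) := by
  induction b with
  | zero => simp [hf.zero]
  | succ b ih =>
    have hs : (b + 1) * (r - 1) ≠ 0 := Nat.mul_ne_zero (by omega) (by omega)
    have h1 := hf.corankProb_mul_le hq hq3 (n := 2 * r - 2) hs (show r ≤ 2 * r - 2 by omega) le_rfl
    rw [corankProb_self, show 2 * r - 2 + 1 - r = r - 1 by omega] at h1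
    have h2 := mul_le_mul_of_nonneg_right h1
      (by positivity : 0 ≤ q⁻¹ ^ ((2 * r - 1) * ((b + 1) * (r - 1))))
    have ht : tri (2 * r - 2) = (2 * r - 1) * (r - 1) := by
      rw [tri_below (r := r) (i := 0) (by omega) (by omega),
        show 2 * r - 2 + 1 - r = r - 1 by omega]
      rfl
    rw [pow_mul_inv_pow_split hq ht (by nlinarith), add_mul, one_mul, Nat.add_sub_cancel] at h2
    rw [add_mul, one_mul]
    linarith

/-- Only the two resonant terms are kept: the self-loop of 2r - 1 and the passage to 2r - 2, of
weight at least 1/2. -/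
theorem add_le_mul_inv_pow (s : ℕ) :
    f (2 * r - 1) s * q⁻¹ ^ ((2 * r - 1) * s) +
      1 / 2 * (f (2 * r - 2) (s + 1) * q⁻¹ ^ ((2 * r - 1) * (s + 1))) ≤
    f (2 * r - 1) (s + r) * q⁻¹ ^ ((2 * r - 1) * (s + r)) := by
  have h1 : corankProb q (2 * r - 1) (2 * r - 2) * f (2 * r - 2) (s + r - (2 * r - 2 + 1 - r)) +
      corankProb q (2 * r - 1) (2 * r - 1) * f (2 * r - 1) (s + r - (2 * r - 1 + 1 - r)) ≤
      f (2 * r - 1) (s + r) := by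
    rw [hf.step (2 * r - 1) (s + r) (by omega), Finset.sum_Ico_succ_top (by omega),
      show 2 * r - 1 = 2 * r - 2 + 1 by omega, Finset.sum_Ico_succ_top (by omega)]
    have : 0 ≤ ∑ k ∈ Finset.Ico r (2 * r - 2), corankProb q (2 * r - 2 + 1) k *
        f k (s + r - (k + 1 - r)) := Finset.sum_nonneg fun i _ =>
      mul_nonneg (corankProb_nonneg hq hq3 _ i) (hf.nonneg _ _)
    linarith
  have h2 := half_mul_le_corankProb hq hq3 (show 2 * r - 2 ≤ 2 * r - 1 by omega)
  have h3 := mul_le_mul_of_nonneg_right h2 (hf.nonneg (2 * r - 2) (s + 1))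
  rw [corankProb_self, show s + r - (2 * r - 2 + 1 - r) = s + 1 by omega,
    show s + r - (2 * r - 1 + 1 - r) = s by omega] at h1
  have h4 := mul_le_mul_of_nonneg_right ((add_le_add_left h3 _).trans h1)
    (by positivity : 0 ≤ q⁻¹ ^ ((2 * r - 1) * (s + r)))
  have ht : tri (2 * r - 2) = (2 * r - 1) * (r - 1) := by
    rw [tri_below (r := r) (i := 0) (by omega) (by omega),
      show 2 * r - 2 + 1 - r = r - 1 by omega]
    rfl
  have ht' : tri (2 * r - 1) = (2 * r - 1) * r := by
    rw [tri_above (r := r) (j := 0) (by omega) (by omega),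
      show 2 * r - 1 + 1 - r = r by omega]
    rfl
  have h5 := pow_mul_inv_pow_split hq ht (show r - 1 ≤ s + r by omega) (f (2 * r - 2) (s + 1))
  have h6 := pow_mul_inv_pow_split hq ht' (show r ≤ s + r by omega) (f (2 * r - 1) s)
  rw [show s + r - (r - 1) = s + 1 by omega] at h5
  rw [show s + r - r = s by omega] at h6
  rw [add_mul, h6, mul_assoc (1 / 2), mul_assoc (1 / 2), h5] at h4
  linarith

theorem add_sum_le_mul_inv_pow (s i : ℕ) :
    f (2 * r - 1) s * q⁻¹ ^ ((2 * r - 1) * s) + 1 / 2 * ∑ j ∈ Finset.range i,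
      f (2 * r - 2) (s + j * r + 1) * q⁻¹ ^ ((2 * r - 1) * (s + j * r + 1)) ≤
    f (2 * r - 1) (s + i * r) * q⁻¹ ^ ((2 * r - 1) * (s + i * r)) := by
  induction i with
  | zero => simp
  | succ i ih =>
    have := hf.add_le_mul_inv_pow hq hq3 hr (s + i * r)
    rw [Finset.sum_range_succ, add_mul, one_mul, ← add_assoc]
    linarith

theorem add_half_le_mul_inv_pow (s : ℕ) :
    f (2 * r - 1) s * q⁻¹ ^ ((2 * r - 1) * s) + 1 / 2 ≤
    f (2 * r - 1) (s + (r - 1) * r) * q⁻¹ ^ ((2 * r - 1) * (s + (r - 1) * r)) := by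
  refine le_trans ?_ (hf.add_sum_le_mul_inv_pow hq hq3 hr s (r - 1))
  -- Since r ≡ 1 mod r - 1, the times s + j r + 1 for j < r - 1 run through all residues mod r - 1,
  -- and one of them is a multiple of r - 1.
  obtain ⟨j, hj, b, hb⟩ : ∃ j < r - 1, ∃ b, s + j * r + 1 = b * (r - 1) := by
    obtain ⟨d, rfl⟩ := Nat.exists_eq_add_of_le' hr
    have hd : d + 2 - 1 = d + 1 := by omega
    rw [hd]
    refine ⟨d - s % (d + 1), by omega, s / (d + 1) + 1 + (d - s % (d + 1)), ?_⟩
    have h1 := Nat.div_add_mod s (d + 1)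
    have h2 := Nat.mod_lt s (show 0 < d + 1 by omega)
    obtain ⟨e, he⟩ := Nat.exists_eq_add_of_le (show s % (d + 1) ≤ d by omega)
    rw [show d - s % (d + 1) = e by omega]
    nlinarith
  have h1 : 1 ≤ ∑ j ∈ Finset.range (r - 1),
      f (2 * r - 2) (s + j * r + 1) * q⁻¹ ^ ((2 * r - 1) * (s + j * r + 1)) := by
    refine (hf.one_le_mul_inv_pow hq hq3 hr b).trans ?_
    rw [← hb]
    exact Finset.single_le_sum (f := fun j => f (2 * r - 2) (s + j * r + 1) *
      q⁻¹ ^ ((2 * r - 1) * (s + j * r + 1)))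
      (fun i _ => mul_nonneg (hf.nonneg _ _) (by positivity)) (Finset.mem_range.2 hj)
  linarith

theorem half_mul_le_mul_inv_pow (a s : ℕ) : (a : ℝ) / 2 ≤
    f (2 * r - 1) (s + a * ((r - 1) * r)) * q⁻¹ ^ ((2 * r - 1) * (s + a * ((r - 1) * r))) := by
  induction a with
  | zero =>
    simp only [Nat.cast_zero, zero_div]
    exact mul_nonneg (hf.nonneg _ _) (by positivity)
  | succ a ih =>
    have := hf.add_half_le_mul_inv_pow hq hq3 hr (s + a * ((r - 1) * r))
    rw [add_mul, one_mul, ← add_assoc]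
    push_cast
    linarith

/-- One passage to 2r - 1 costs a factor 1/2 and time r; each later period r(r - 1) gains 1/2. The
floor of (m - r)/(r(r - 1)) is at least half of m/(r(r - 1)) once m ≥ 2r², which gives 1/8. -/
theorem le_mul_inv_pow {n m : ℕ} (hn : 2 * r ≤ n + 1) (hm : 2 * r ^ 2 ≤ m) :
    1 / 8 * ((m : ℝ) / (r * (r - 1))) ≤ f n m * q⁻¹ ^ ((2 * r - 1) * m) := by
  have hrm : r ≤ m := by nlinarith
  have h1 := hf.corankProb_mul_le hq hq3 (n := n) (k := 2 * r - 1) (s := m) (by omega) (by omega)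
    (by omega)
  have h2 := half_mul_le_corankProb hq hq3 (show 2 * r - 1 ≤ n by omega)
  rw [show 2 * r - 1 + 1 - r = r by omega] at h1
  have h3 := mul_le_mul_of_nonneg_right h2 (hf.nonneg (2 * r - 1) (m - r))
  have h4 := mul_le_mul_of_nonneg_right (h3.trans h1)
    (by positivity : 0 ≤ q⁻¹ ^ ((2 * r - 1) * m))
  have ht' : tri (2 * r - 1) = (2 * r - 1) * r := by
    rw [tri_above (r := r) (j := 0) (by omega) (by omega),
      show 2 * r - 1 + 1 - r = r by omega]
    rfl
  rw [mul_assoc (1 / 2), mul_assoc (1 / 2), pow_mul_inv_pow_split hq ht' hrm] at h4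
  set D := (r - 1) * r with hD
  have hDpos : 0 < D := Nat.mul_pos (by omega) (by omega)
  have h5 := hf.half_mul_le_mul_inv_pow hq hq3 hr ((m - r) / D) ((m - r) % D)
  rw [← hD, mul_comm ((m - r) / D) D, Nat.mod_add_div] at h5
  have hDr : (D : ℝ) = r * (r - 1) := by
    rw [hD, Nat.cast_mul, Nat.cast_sub (by omega)]
    push_cast
    ring
  have h6 : ((m : ℝ) - r) / D - 1 ≤ ((m - r) / D : ℕ) := by
    have h7 := Nat.lt_div_mul_add hDpos (a := m - r)
    have h8 : ((m - r : ℕ) : ℝ) ≤ ((m - r) / D : ℕ) * D + D := by exact_mod_cast h7.le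
    rw [Nat.cast_sub hrm] at h8
    have : (0 : ℝ) < D := by exact_mod_cast hDpos
    rw [sub_le_iff_le_add, div_le_iff₀ this]
    linarith
  have h9 : (m : ℝ) / D / 2 ≤ (m - r) / D - 1 := by
    have hD0 : (0 : ℝ) < D := by exact_mod_cast hDpos
    have hm' : (2 : ℝ) * r ^ 2 ≤ m := by exact_mod_cast hm
    rw [div_div, sub_eq_add_neg, div_add' _ _ _ hD0.ne', div_le_div_iff₀ (by positivity) hD0]
    rw [hDr] at hD0 ⊢
    nlinarith
  rw [← hDr]
  linarith

end RankRec

/-! ### Assembling the four statements -/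

theorem inv_prime_le_third {p : ℕ} (hp : p.Prime) (ho : Odd p) : (p : ℝ)⁻¹ ≤ 1 / 3 := by
  have h3 : 3 ≤ p := by
    have := hp.two_le
    rcases ho with ⟨k, hk⟩
    omega
  rw [one_div]
  exact inv_anti₀ (by norm_num) (by exact_mod_cast h3)

theorem two_mul_le_of_le_ceil {n r : ℕ} (h : r ≤ ⌈(n : ℝ) / 2⌉₊) : 2 * r ≤ n + 1 := by
  have h1 := Nat.ceil_lt_add_one (show (0 : ℝ) ≤ n / 2 by positivity)
  have h2 : (r : ℝ) ≤ (⌈(n : ℝ) / 2⌉₊ : ℝ) := by exact_mod_cast h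
  have h3 : (2 * r : ℝ) < n + 2 := by linarith
  have h4 : 2 * r < n + 2 := by exact_mod_cast h3
  omega

theorem add_two_le_of_ceil_lt {n r : ℕ} (h : ⌈(n : ℝ) / 2⌉₊ < r) : n + 2 ≤ 2 * r := by
  have h1 := Nat.le_ceil ((n : ℝ) / 2)
  have h2 : ((⌈(n : ℝ) / 2⌉₊ + 1 : ℕ) : ℝ) ≤ r := by exact_mod_cast h
  push_cast at h2
  have h3 : (n + 2 : ℝ) ≤ 2 * r := by linarith
  exact_mod_cast h3

theorem le_mul_pow_of_mul_inv_pow_le {q x C : ℝ} (hq : 0 < q) {a : ℕ} (h : x * q⁻¹ ^ a ≤ C) :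
    x ≤ C * q ^ a := by
  rwa [inv_pow, ← div_eq_mul_inv, div_le_iff₀ (by positivity)] at h

theorem mul_pow_le_of_le_mul_inv_pow {q x C : ℝ} (hq : 0 < q) {a : ℕ} (h : C ≤ x * q⁻¹ ^ a) :
    C * q ^ a ≤ x := by
  rwa [inv_pow, ← div_eq_mul_inv, le_div_iff₀ (by positivity)] at h

theorem mainTheorem9 :
    -- rank at most `n - 1`: asymptotic equivalence as `m → ∞`, uniformly in `n` and `p`
    (∀ ε : ℝ, 0 < ε → ∃ M : ℕ, ∀ m : ℕ, M ≤ m → ∀ p : ℕ, p.Prime → Odd p → ∀ n : ℕ, 1 ≤ n →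
      |probRankLe p m n 1 /
          ((1 - (p : ℝ)⁻¹ ^ n) / (1 - (p : ℝ)⁻¹) * (p : ℝ)⁻¹ ^ m) - 1| ≤ ε) ∧
    -- rank at most `n - r` with `2 ≤ r ≤ ⌈n/2⌉`: lower bound, as `m → ∞` for each `r`
    (∃ c : ℝ, 0 < c ∧ ∀ r : ℕ, 2 ≤ r → ∃ M : ℕ, ∀ m : ℕ, M ≤ m →
      ∀ p : ℕ, p.Prime → Odd p → ∀ n : ℕ, r ≤ ⌈(n : ℝ) / 2⌉₊ →
        c * ((m : ℝ) / ((r : ℝ) * ((r : ℝ) - 1)) * (p : ℝ)⁻¹ ^ (m * (2 * r - 1))) ≤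
          probRankLe p m n r) ∧
    -- rank at most `n - r` with `2 ≤ r ≤ ⌈n/2⌉`: upper bound
    (∃ C : ℝ, 0 < C ∧ ∀ p : ℕ, p.Prime → Odd p → ∀ m : ℕ, 2 ≤ m →
      ∀ n r : ℕ, 2 ≤ r → r ≤ ⌈(n : ℝ) / 2⌉₊ →
        probRankLe p m n r ≤
          C * ((m : ℝ) * Real.log ((min m n : ℕ) : ℝ) * (p : ℝ)⁻¹ ^ (m * (2 * r - 1)))) ∧
    -- rank at most `n - r` with `r > ⌈n/2⌉`
    (∃ C : ℝ, 0 < C ∧ ∀ p : ℕ, p.Prime → Odd p → ∀ m : ℕ, 1 ≤ m →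
      ∀ n r : ℕ, 1 ≤ n → ⌈(n : ℝ) / 2⌉₊ < r →
        probRankLe p m n r ≤ C * (p : ℝ)⁻¹ ^ (m * n)) := by
  refine ⟨fun ε hε => ?_, ⟨1 / 8, by norm_num, fun r hr => ⟨2 * r ^ 2, fun m hm p hp ho n hn => ?_⟩⟩,
    -- The bound 100(1 + m) ≤ 200 m is divided by log 2, the least value of the logarithm.
    ⟨200 / Real.log 2, div_pos (by norm_num) (Real.log_pos (by norm_num)),
      fun p hp ho m hm n r hr hn => ?_⟩, ⟨1, one_pos, fun p hp ho m hm n r hn hr => ?_⟩⟩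
  · obtain ⟨N, hN⟩ := exists_pow_lt_of_lt_one (show 0 < ε / (3 / 2) by positivity)
      (show (9 / 10 : ℝ) < 1 by norm_num)
    refine ⟨N + 1, fun m hm p hp ho n hn => ?_⟩
    have : Fact p.Prime := ⟨hp⟩
    have hq : (0 : ℝ) < (p : ℝ)⁻¹ := inv_pos.2 (by exact_mod_cast hp.pos)
    have hq3 := inv_prime_le_third hp ho
    have hf := symProb_rankRec p 1
    rw [probRankLe_eq_symProb p (by omega)]
    have h1 := hf.mul_inv_pow_le_limit hq hq3 m n hn
    have h2 := hf.limit_le_mul_inv_pow hq hq3 m n hn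
    have h3 := RankRec.one_le_limit hq hq3 hn
    set L := (1 - (p : ℝ)⁻¹ ^ n) / (1 - (p : ℝ)⁻¹)
    have h4 : (9 / 10 : ℝ) ^ m ≤ (9 / 10) ^ N :=
      pow_le_pow_of_le_one (by norm_num) (by norm_num) (by omega)
    have h5 : symProb p 1 n m / (L * (p : ℝ)⁻¹ ^ m) = symProb p 1 n m * (p : ℝ)⁻¹⁻¹ ^ m / L := by
      rw [inv_pow (p : ℝ)⁻¹, ← div_eq_mul_inv, div_div, mul_comm L]
    rw [h5, abs_le]
    rw [lt_div_iff₀ (by norm_num)] at hN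
    have h6 : 0 < L := by linarith
    constructor
    · rw [neg_le_sub_iff_le_add, ← sub_le_iff_le_add, le_div_iff₀ h6]
      nlinarith
    · rw [sub_le_iff_le_add, div_le_iff₀ h6]
      nlinarith
  · have : Fact p.Prime := ⟨hp⟩
    have hq : (0 : ℝ) < (p : ℝ)⁻¹ := inv_pos.2 (by exact_mod_cast hp.pos)
    have hq3 := inv_prime_le_third hp ho
    rw [probRankLe_eq_symProb p (by nlinarith), mul_comm m, ← mul_assoc]
    exact mul_pow_le_of_le_mul_inv_pow hq ((symProb_rankRec p r).le_mul_inv_pow hq hq3 hr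
      (two_mul_le_of_le_ceil hn) hm)
  · have : Fact p.Prime := ⟨hp⟩
    have hq : (0 : ℝ) < (p : ℝ)⁻¹ := inv_pos.2 (by exact_mod_cast hp.pos)
    have hq3 := inv_prime_le_third hp ho
    have hn' := two_mul_le_of_le_ceil hn
    rw [probRankLe_eq_symProb p (by omega), mul_comm m, ← mul_assoc]
    obtain ⟨θ, hθ, hθ1, hθr⟩ := exists_pow_eq_half hr
    refine le_mul_pow_of_mul_inv_pow_le hq (((symProb_rankRec p r).mul_inv_pow_le_of_le hq hq3 hr
      hθ hθ1 hθr m n hn').trans ?_)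
    have hlog : 0 < Real.log 2 := Real.log_pos (by norm_num)
    -- Here r ≥ 2 and 2r ≤ n + 1 force n ≥ 3, so `min m n` is at least 2.
    have hmin : Real.log 2 ≤ Real.log ((min m n : ℕ) : ℝ) :=
      Real.log_le_log (by norm_num) (by exact_mod_cast (show 2 ≤ min m n by omega))
    have hm1 : (2 : ℝ) ≤ m := by exact_mod_cast hm
    calc 100 * (1 + (m : ℝ)) ≤ 200 * m := by linarith
      _ = 200 / Real.log 2 * (m * Real.log 2) := by field_simp
      _ ≤ 200 / Real.log 2 * (m * Real.log ((min m n : ℕ) : ℝ)) := by gcongr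
  · have : Fact p.Prime := ⟨hp⟩
    have hq : (0 : ℝ) < (p : ℝ)⁻¹ := inv_pos.2 (by exact_mod_cast hp.pos)
    have hq3 := inv_prime_le_third hp ho
    rw [probRankLe_eq_symProb p (by omega), mul_comm m]
    exact le_mul_pow_of_mul_inv_pow_le hq ((symProb_rankRec p r).mul_inv_pow_le_one hq hq3
      (add_two_le_of_ceil_lt hr) m n le_rfl)
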